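/- Let $k$ be a commutative ring and $G$ a group. Algebras are associative $k$-algebras, not necessarily with unit, and $\otimes=\otimes_k$. A left module $M$ over an algebra $R$ is unital if the canonical map $R\otimes_R M\to M$ is an isomorphism, and an algebra $A$ is unital if $A\otimes_A A\to A$ is an isomorphism; put $A^{\rm e}=A\otimes A^{\rm op}$. A Taylor–Azumaya algebra is a unital algebra $A$, faithful as a $k$-module, for which the adjoint functors $N\mapsto A\otimes N$, from $k$-modules to unital left $A^{\rm e}$-modules, and $M\mapsto {\rm Hom}_{A^{\rm e}}(A,M)$ are inverse equivalences. It is a $G$-module Taylor–Azumaya algebra if $G$ acts on it by $k$-algebra automorphisms. For a $G$-module Taylor–Azumaya algebra $A$, let $A\# kG=\bigoplus_{g\in G}A\# g$ be the smash product, with $(a\# g)(b\# h)=a(g\cdot b)\# gh$ and with the $A^{\rm e}$-module structure $(a\otimes a')\cdot (b\# g)=ab(g\cdot a')\# g$. The $k$-module ${\rm Hom}_{A^{\rm e}}(A,A\# kG)$ is an algebra with unit $a\mapsto a\# 1$ and with the product determined by $(\varphi\psi)(ab)=\varphi(a)\psi(b)$; its part of degree $g$ consists of the $\varphi$ with $\varphi(A)\subseteq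 A\# g$. For $G$-graded algebras $S$ and $T$ with unit, the cotensor product is the $G$-graded algebra $S\square T=\bigoplus_{g\in G}S_g\otimes T_g$, with $(s\otimes t)(s'\otimes t')=ss'\otimes tt'$. Let $A$ and $B$ be $G$-module Taylor–Azumaya algebras, and let $G$ act diagonally on $A\otimes B$. Then ${\rm Hom}_{A^{\rm e}}(A,A\# kG)$, ${\rm Hom}_{B^{\rm e}}(B,B\# kG)$ and ${\rm Hom}_{(A\otimes B)^{\rm e}}(A\otimes B,(A\otimes B)\# kG)$ are $G$-graded algebras (each is the direct sum of its homogeneous parts), and there is an isomorphism of $G$-graded $k$-algebras $${\rm Hom}_{A^{\rm e}}(A,A\# kG)\,\square\,{\rm Hom}_{B^{\rm e}}(B,B\# kG)\;\cong\;{\rm Hom}_{(A\otimes B)^{\rm e}}\bigl(A\otimes B,(A\otimes B)\# kG\bigr).$$ -/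

import Mathlib

open scoped TensorProduct DirectSum

universe u

noncomputable section

namespace TaylorAzumaya

/-! ### Modules over algebras without unit

A left module over a (not necessarily unital) `k`-algebra `R` is a `k`-module `M` together with a
homomorphism `ρ : R →ₙₐ[k] Module.End k M` of algebras without unit. -/

section Modules

variable {k R M M' : Type u} [CommRing k] [NonUnitalRing R] [Module k R]
  [AddCommGroup M] [Module k M] [AddCommGroup M'] [Module k M']

/-- The submodule of `R ⊗[k] M` generated by the elements `rs ⊗ m - r ⊗ sm`. -/
def balancing (ρ : R →ₙₐ[k] Module.End k M) : Submodule k (R ⊗[k] M) :=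
  Submodule.span k {t | ∃ (r s : R) (m : M), t = (r * s) ⊗ₜ[k] m - r ⊗ₜ[k] (ρ s m)}

/-- The tensor product `R ⊗_R M`. -/
abbrev RelTensor (ρ : R →ₙₐ[k] Module.End k M) : Type u := (R ⊗[k] M) ⧸ balancing ρ

/-- The map `R ⊗[k] M → M`, `r ⊗ m ↦ rm`. -/
def actMap (ρ : R →ₙₐ[k] Module.End k M) : R ⊗[k] M →ₗ[k] M :=
  TensorProduct.lift (ρ : R →ₗ[k] Module.End k M)

@[simp] theorem actMap_tmul (ρ : R →ₙₐ[k] Module.End k M) (r : R) (m : M) :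
    actMap ρ (r ⊗ₜ m) = ρ r m := rfl

theorem balancing_le_ker (ρ : R →ₙₐ[k] Module.End k M) :
    balancing ρ ≤ LinearMap.ker (actMap ρ) := by
  refine Submodule.span_le.2 ?_
  rintro _ ⟨r, s, m, rfl⟩
  simp [map_mul]

/-- The canonical map `R ⊗_R M → M`, `r ⊗ m ↦ rm`. -/
def relAct (ρ : R →ₙₐ[k] Module.End k M) : RelTensor ρ →ₗ[k] M :=
  (balancing ρ).liftQ (actMap ρ) (balancing_le_ker ρ)

/-- A left `R`-module `M` is unital if the canonical map `R ⊗_R M → M` is an isomorphism. -/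
def IsUnitalModule (ρ : R →ₙₐ[k] Module.End k M) : Prop :=
  Function.Bijective (relAct ρ)

/-- The `k`-module `Hom_R(M, M')` of `R`-linear maps. -/
def moduleHom (ρ : R →ₙₐ[k] Module.End k M) (ρ' : R →ₙₐ[k] Module.End k M') :
    Submodule k (M →ₗ[k] M') where
  carrier := {f | ∀ (r : R) (m : M), f (ρ r m) = ρ' r (f m)}
  add_mem' hf hg r m := by simp [hf r m, hg r m]
  zero_mem' r m := by simp
  smul_mem' c f hf r m := by simp [hf r m]

/-- The left `R`-module `M ⊗[k] N`, with action `r(m ⊗ n) = rm ⊗ n`. -/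
def tensorAct (ρ : R →ₙₐ[k] Module.End k M) (N : Type u) [AddCommGroup N] [Module k N] :
    R →ₙₐ[k] Module.End k (M ⊗[k] N) where
  toFun r := (ρ r).rTensor N
  map_smul' c r := by simp [LinearMap.rTensor_smul]
  map_zero' := by simp
  map_add' r s := by simp [LinearMap.rTensor_add]
  map_mul' r s := by rw [map_mul, Module.End.mul_eq_comp, LinearMap.rTensor_comp]; rfl

end Modules

/-! ### Taylor–Azumaya algebras -/

section Algebras

variable (k A : Type u) [CommRing k]
  [NonUnitalRing A] [Module k A] [IsScalarTower k A A] [SMulCommClass k A A]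

/-- An algebra `A`, with or without unit element, is called unital if the canonical map
`A ⊗_A A → A` is an isomorphism. -/
class IsUnitalAlgebra : Prop where
  unital : IsUnitalModule (NonUnitalAlgHom.lmul k A)

variable {k A}
variable {S : Type u} [NonUnitalRing S] [Module k S] [IsScalarTower k S S] [SMulCommClass k S S]

/-- A homomorphism of algebras `η : A → S` makes `S` an `A`-bimodule, that is, a left module
over the enveloping algebra `A ⊗ Aᵒᵖ`, with action `(a ⊗ a') s = η(a) s η(a')`. -/
def envAct (η : A →ₙₐ[k] S) : A ⊗[k] Aᵐᵒᵖ →ₙₐ[k] Module.End k S :=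
  let L : A ⊗[k] Aᵐᵒᵖ →ₗ[k] Module.End k S := TensorProduct.lift
    (LinearMap.mk₂ k
      (fun a (a' : Aᵐᵒᵖ) => LinearMap.mulLeft k (η a) ∘ₗ LinearMap.mulRight k (η a'.unop))
      (fun a b c => by ext; simp [add_mul])
      (fun c a b => by ext; simp [smul_mul_assoc])
      (fun a b c => by ext; simp [mul_add])
      (fun c a b => by ext; simp [mul_smul_comm]))
  { toFun := L
    map_smul' := fun c x => by simp
    map_zero' := map_zero L
    map_add' := map_add L
    map_mul' := fun x y => by
      induction x with
      | zero => simp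
      | add x x' hx hx' => rw [add_mul, map_add, hx, hx', map_add, add_mul]
      | tmul a a' =>
        induction y with
        | zero => simp
        | add y y' hy hy' => rw [mul_add, map_add, hy, hy', map_add, mul_add]
        | tmul b b' => ext s; simp [L, mul_assoc] }

@[simp] theorem envAct_tmul (η : A →ₙₐ[k] S) (a : A) (a' : Aᵐᵒᵖ) (s : S) :
    envAct η (a ⊗ₜ a') s = η a * (s * η a'.unop) := rfl

variable (k A)

/-- `A` as a left module over its enveloping algebra, with action `(a ⊗ a') b = a b a'`. -/
abbrev selfAct : A ⊗[k] Aᵐᵒᵖ →ₙₐ[k] Module.End k A := envAct (NonUnitalAlgHom.id k A)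

/-- The unit `N → Hom_{Aᵉ}(A, A ⊗ N)`, `n ↦ (a ↦ a ⊗ n)`, of the adjunction between the functors
`A ⊗ -` and `Hom_{Aᵉ}(A, -)`. -/
def unitMap (N : Type u) [AddCommGroup N] [Module k N] :
    N →ₗ[k] moduleHom (selfAct k A) (tensorAct (selfAct k A) N) :=
  LinearMap.codRestrict _ (TensorProduct.mk k A N).flip fun _ _ _ => rfl

/-- The counit `A ⊗ Hom_{Aᵉ}(A, M) → M`, `a ⊗ f ↦ f(a)`, of the adjunction between the functors
`A ⊗ -` and `Hom_{Aᵉ}(A, -)`. -/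
def counitMap {M : Type u} [AddCommGroup M] [Module k M]
    (ρ : A ⊗[k] Aᵐᵒᵖ →ₙₐ[k] Module.End k M) :
    A ⊗[k] moduleHom (selfAct k A) ρ →ₗ[k] M :=
  TensorProduct.lift (Submodule.subtype (moduleHom (selfAct k A) ρ)).flip

/-- A Taylor–Azumaya algebra is a unital algebra `A`, faithful as a `k`-module, for which the
adjoint functors `N ↦ A ⊗ N`, from `k`-modules to unital left `Aᵉ`-modules, and
`M ↦ Hom_{Aᵉ}(A, M)` are inverse equivalences: the unit and the counit are isomorphisms. -/
class IsTaylorAzumaya : Prop extends IsUnitalAlgebra k A where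
  faithful : ∀ c : k, (∀ a : A, c • a = 0) → c = 0
  unit_bijective : ∀ (N : Type u) [AddCommGroup N] [Module k N],
    Function.Bijective (unitMap k A N)
  counit_bijective : ∀ (M : Type u) [AddCommGroup M] [Module k M]
    (ρ : A ⊗[k] Aᵐᵒᵖ →ₙₐ[k] Module.End k M), IsUnitalModule ρ →
    Function.Bijective (counitMap k A ρ)

/-! ### The algebra `Hom_{Aᵉ}(A, S)` -/

variable {k A}

/-- For a homomorphism of algebras `η : A → S`, the `k`-module `Hom_{Aᵉ}(A, S)`. -/
abbrev EnvHom (η : A →ₙₐ[k] S) : Submodule k (A →ₗ[k] S) := moduleHom (selfAct k A) (envAct η)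

/-- A unital algebra is spanned by products. -/
theorem span_mul_eq_top [IsUnitalAlgebra k A] :
    Submodule.span k {x : A | ∃ a b : A, a * b = x} = ⊤ := by
  rw [eq_top_iff]
  rintro x -
  obtain ⟨t, rfl⟩ := (IsUnitalAlgebra.unital (k := k) (A := A)).2 x
  obtain ⟨t, rfl⟩ := Submodule.Quotient.mk_surjective _ t
  change actMap _ t ∈ _
  induction t with
  | zero => simp
  | add x y hx hy => rw [map_add]; exact add_mem hx hy
  | tmul a b => exact Submodule.subset_span ⟨a, b, rfl⟩

@[elab_as_elim]
theorem mul_induction [IsUnitalAlgebra k A] {p : A → Prop} (x : A) (zero : p 0)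
    (mul : ∀ a b, p (a * b)) (add : ∀ x y, p x → p y → p (x + y)) : p x := by
  have hx : x ∈ Submodule.span k {x : A | ∃ a b : A, a * b = x} := by
    rw [span_mul_eq_top]; trivial
  refine Submodule.closure_induction (p := fun x _ => p x) zero (fun x y _ _ => add x y) ?_ hx
  intro c y hy
  obtain ⟨a, b, rfl⟩ := hy
  rw [← smul_mul_assoc]
  exact mul _ _

theorem EnvHom.map_mul_left [IsUnitalAlgebra k A] {η : A →ₙₐ[k] S} (f : EnvHom η) (a b : A) :
    f.1 (a * b) = η a * f.1 b := by
  refine mul_induction (k := k) b (by simp) (fun b d => ?_)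
    (fun x y hx hy => by rw [mul_add, map_add, hx, hy, map_add, mul_add])
  refine mul_induction (k := k) b (by simp) (fun b c => ?_)
    (fun x y hx hy => by rw [add_mul, mul_add, map_add, hx, hy, map_add, mul_add])
  have h1 := f.2 ((a * b) ⊗ₜ MulOpposite.op d) c
  have h2 := f.2 (b ⊗ₜ MulOpposite.op d) c
  simp only [envAct_tmul, NonUnitalAlgHom.coe_id, id_eq, MulOpposite.unop_op, map_mul] at h1 h2
  rw [mul_assoc b c d, h2, ← mul_assoc a b, h1, mul_assoc]

theorem EnvHom.map_mul_right [IsUnitalAlgebra k A] {η : A →ₙₐ[k] S} (f : EnvHom η) (a b : A) :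
    f.1 (a * b) = f.1 a * η b := by
  refine mul_induction (k := k) a (by simp) (fun a d => ?_)
    (fun x y hx hy => by rw [add_mul, map_add, hx, hy, map_add, add_mul])
  refine mul_induction (k := k) d (by simp) (fun c d => ?_)
    (fun x y hx hy => by rw [mul_add, add_mul, map_add, hx, hy, map_add, add_mul])
  have h1 := f.2 (a ⊗ₜ MulOpposite.op (d * b)) c
  have h2 := f.2 (a ⊗ₜ MulOpposite.op d) c
  simp only [envAct_tmul, NonUnitalAlgHom.coe_id, id_eq, MulOpposite.unop_op, map_mul] at h1 h2
  rw [h2, mul_assoc a, mul_assoc c, h1]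
  simp only [mul_assoc]

theorem EnvHom.mem_of_map_mul {η : A →ₙₐ[k] S} (f : A →ₗ[k] S)
    (hl : ∀ a b, f (a * b) = η a * f b) (hr : ∀ a b, f (a * b) = f a * η b) : f ∈ EnvHom η := by
  intro r m
  induction r with
  | zero => simp
  | add x y hx hy => simp only [map_add, LinearMap.add_apply, hx, hy]
  | tmul a a' =>
    simp only [envAct_tmul, NonUnitalAlgHom.coe_id, id_eq]
    rw [hl, hr]

/-- The product on `Hom_{Aᵉ}(A, S)` as a linear map:
`A ≅ A ⊗_A A → S ⊗ S → S`, with `(φψ)(ab) = φ(a)ψ(b)`. -/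
def EnvHom.mulAux [IsUnitalAlgebra k A] {η : A →ₙₐ[k] S} (φ ψ : EnvHom η) : A →ₗ[k] S :=
  (balancing (NonUnitalAlgHom.lmul k A)).liftQ
      (LinearMap.mul' k S ∘ₗ TensorProduct.map φ.1 ψ.1) (by
        refine Submodule.span_le.2 ?_
        rintro _ ⟨a, b, c, rfl⟩
        simp [EnvHom.map_mul_left ψ, EnvHom.map_mul_right φ, mul_assoc])
    ∘ₗ (LinearEquiv.ofBijective _ (IsUnitalAlgebra.unital (k := k) (A := A))).symm.toLinearMap

theorem EnvHom.mulAux_apply [IsUnitalAlgebra k A] {η : A →ₙₐ[k] S} (φ ψ : EnvHom η) (a b : A) :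
    EnvHom.mulAux φ ψ (a * b) = φ.1 a * ψ.1 b := by
  have h : (LinearEquiv.ofBijective _ (IsUnitalAlgebra.unital (k := k) (A := A))).symm (a * b)
      = Submodule.Quotient.mk (a ⊗ₜ b) := by
    rw [LinearEquiv.symm_apply_eq]; rfl
  simp only [EnvHom.mulAux, LinearMap.comp_apply, LinearEquiv.coe_coe, h]
  rfl

theorem EnvHom.mulAux_mem [IsUnitalAlgebra k A] {η : A →ₙₐ[k] S} (φ ψ : EnvHom η) :
    EnvHom.mulAux φ ψ ∈ EnvHom η := by
  refine EnvHom.mem_of_map_mul _ (fun a b => ?_) (fun a b => ?_)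
  · refine mul_induction (k := k) b (by simp) (fun b c => ?_)
      (fun x y hx hy => by rw [mul_add, map_add, hx, hy, map_add, mul_add])
    rw [← mul_assoc, EnvHom.mulAux_apply, EnvHom.mulAux_apply, EnvHom.map_mul_left, mul_assoc]
  · refine mul_induction (k := k) a (by simp) (fun a c => ?_)
      (fun x y hx hy => by rw [add_mul, map_add, hx, hy, map_add, add_mul])
    rw [mul_assoc, EnvHom.mulAux_apply, EnvHom.mulAux_apply, EnvHom.map_mul_right, mul_assoc]

instance EnvHom.instMul [IsUnitalAlgebra k A] (η : A →ₙₐ[k] S) : Mul (EnvHom η) :=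
  ⟨fun φ ψ => ⟨EnvHom.mulAux φ ψ, EnvHom.mulAux_mem φ ψ⟩⟩

instance EnvHom.instOne (η : A →ₙₐ[k] S) : One (EnvHom η) :=
  ⟨⟨(η : A →ₗ[k] S), EnvHom.mem_of_map_mul _ (by simp) (by simp)⟩⟩

theorem EnvHom.mul_apply [IsUnitalAlgebra k A] {η : A →ₙₐ[k] S} (φ ψ : EnvHom η) (a b : A) :
    (φ * ψ).1 (a * b) = φ.1 a * ψ.1 b := EnvHom.mulAux_apply φ ψ a b

theorem EnvHom.one_apply {η : A →ₙₐ[k] S} (a : A) : (1 : EnvHom η).1 a = η a := rfl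

theorem EnvHom.ext_mul [IsUnitalAlgebra k A] {η : A →ₙₐ[k] S} {φ ψ : EnvHom η}
    (h : ∀ a b, φ.1 (a * b) = ψ.1 (a * b)) : φ = ψ := by
  refine Subtype.ext (LinearMap.ext fun x => ?_)
  exact mul_induction (k := k) x (by simp) h (fun x y hx hy => by rw [map_add, hx, hy, map_add])

instance EnvHom.instRing [IsUnitalAlgebra k A] (η : A →ₙₐ[k] S) : Ring (EnvHom η) where
  __ := (inferInstance : AddCommGroup (EnvHom η))
  __ := EnvHom.instMul η
  __ := EnvHom.instOne η
  left_distrib φ ψ χ := EnvHom.ext_mul fun a b => by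
    change _ = (φ * ψ).1 (a * b) + (φ * χ).1 (a * b)
    simp only [EnvHom.mul_apply]
    exact mul_add _ _ _
  right_distrib φ ψ χ := EnvHom.ext_mul fun a b => by
    change _ = (φ * χ).1 (a * b) + (ψ * χ).1 (a * b)
    simp only [EnvHom.mul_apply]
    exact add_mul _ _ _
  zero_mul φ := EnvHom.ext_mul fun a b => by
    rw [EnvHom.mul_apply]; exact zero_mul _
  mul_zero φ := EnvHom.ext_mul fun a b => by
    rw [EnvHom.mul_apply]; exact mul_zero _
  mul_assoc φ ψ χ := EnvHom.ext_mul fun a b => by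
    refine mul_induction (k := k) a (by simp) (fun a c => ?_)
      (fun x y hx hy => by rw [add_mul, map_add, hx, hy, map_add])
    rw [EnvHom.mul_apply, EnvHom.mul_apply, mul_assoc a c b, EnvHom.mul_apply, EnvHom.mul_apply,
      mul_assoc]
  one_mul φ := EnvHom.ext_mul fun a b => by
    rw [EnvHom.mul_apply, EnvHom.one_apply, EnvHom.map_mul_left]
  mul_one φ := EnvHom.ext_mul fun a b => by
    rw [EnvHom.mul_apply, EnvHom.one_apply, EnvHom.map_mul_right]
  neg_add_cancel φ := neg_add_cancel φ
  zsmul := (· • ·)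
  zsmul_zero' := zero_zsmul
  zsmul_succ' := fun n a => by simp [add_zsmul]
  zsmul_neg' := fun n a => by simp [add_zsmul, Int.negSucc_eq]

instance EnvHom.instAlgebra [IsUnitalAlgebra k A] (η : A →ₙₐ[k] S) : Algebra k (EnvHom η) :=
  Algebra.ofModule
    (fun c φ ψ => EnvHom.ext_mul fun a b => by
      change _ = c • (φ * ψ).1 (a * b)
      simp only [EnvHom.mul_apply]
      exact smul_mul_assoc _ _ _)
    (fun c φ ψ => EnvHom.ext_mul fun a b => by
      change _ = c • (φ * ψ).1 (a * b)
      simp only [EnvHom.mul_apply]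
      exact mul_smul_comm _ _ _)

end Algebras

/-! ### The tensor product of unital algebras is unital -/

section Tensor

variable {k A B : Type u} [CommRing k]
  [NonUnitalRing A] [Module k A] [IsScalarTower k A A] [SMulCommClass k A A]
  [NonUnitalRing B] [Module k B] [IsScalarTower k B B] [SMulCommClass k B B]

theorem relTensor_move (a b c : A) :
    (Submodule.Quotient.mk ((a * b) ⊗ₜ[k] c) : RelTensor (NonUnitalAlgHom.lmul k A))
      = Submodule.Quotient.mk (a ⊗ₜ[k] (b * c)) :=
  (Submodule.Quotient.eq _).2 (Submodule.subset_span ⟨a, b, c, rfl⟩)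

/-- Two `k`-linear maps out of a unital algebra that agree on products are equal. -/
theorem ext_on_mul [IsUnitalAlgebra k A] {M : Type u} [AddCommGroup M] [Module k M]
    {f g : A →ₗ[k] M} (h : ∀ a b, f (a * b) = g (a * b)) : f = g :=
  LinearMap.ext fun x => mul_induction (k := k) x (by rw [map_zero, map_zero]) h
    (fun x y hx hy => by rw [map_add, hx, hy, map_add])

/-- In `(A ⊗ B) ⊗_{A ⊗ B} (A ⊗ B)` factors from `A` may be moved across the tensor sign. -/
theorem relTensor_move_left [IsUnitalAlgebra k A] [IsUnitalAlgebra k B] (a c d : A) (x y : B) :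
    (Submodule.Quotient.mk (((a * c) ⊗ₜ[k] x) ⊗ₜ[k] (d ⊗ₜ[k] y)) :
      RelTensor (NonUnitalAlgHom.lmul k (A ⊗[k] B)))
      = Submodule.Quotient.mk ((a ⊗ₜ[k] x) ⊗ₜ[k] ((c * d) ⊗ₜ[k] y)) := by
  let q := (balancing (NonUnitalAlgHom.lmul k (A ⊗[k] B))).mkQ
  change q _ = q _
  have indA : ∀ {p : A → Prop} (x : A) (zero : p 0) (mul : ∀ a b, p (a * b))
      (add : ∀ x y, p x → p y → p (x + y)), p x :=
    fun x zero mul add => mul_induction (k := k) x zero mul add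
  have indB : ∀ {p : B → Prop} (x : B) (zero : p 0) (mul : ∀ a b, p (a * b))
      (add : ∀ x y, p x → p y → p (x + y)), p x :=
    fun x zero mul add => mul_induction (k := k) x zero mul add
  have mv : ∀ u v w : A ⊗[k] B, q ((u * v) ⊗ₜ w) = q (u ⊗ₜ (v * w)) := relTensor_move
  induction d using indA with
  | zero => simp
  | add d d' h h' => simp only [mul_add, TensorProduct.add_tmul, TensorProduct.tmul_add, map_add, h, h']
  | mul d e =>
    induction y using indB with
    | zero => simp
    | add y y' h h' => simp only [TensorProduct.tmul_add, map_add, h, h']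
    | mul y z =>
      induction z using indB with
      | zero => simp
      | add z z' h h' => simp only [mul_add, TensorProduct.tmul_add, map_add, h, h']
      | mul z w =>
        have h1 := mv ((a * c) ⊗ₜ x) (d ⊗ₜ (y * z)) (e ⊗ₜ w)
        have h2 := mv (a ⊗ₜ x) ((c * d) ⊗ₜ (y * z)) (e ⊗ₜ w)
        simp only [Algebra.TensorProduct.tmul_mul_tmul] at h1 h2
        rw [← mul_assoc y z w, ← h1, ← mul_assoc c d e, ← h2, mul_assoc a c d]

/-- In `(A ⊗ B) ⊗_{A ⊗ B} (A ⊗ B)` factors from `B` may be moved across the tensor sign. -/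
theorem relTensor_move_right [IsUnitalAlgebra k A] [IsUnitalAlgebra k B] (a d : A) (x z y : B) :
    (Submodule.Quotient.mk ((a ⊗ₜ[k] (x * z)) ⊗ₜ[k] (d ⊗ₜ[k] y)) :
      RelTensor (NonUnitalAlgHom.lmul k (A ⊗[k] B)))
      = Submodule.Quotient.mk ((a ⊗ₜ[k] x) ⊗ₜ[k] (d ⊗ₜ[k] (z * y))) := by
  let q := (balancing (NonUnitalAlgHom.lmul k (A ⊗[k] B))).mkQ
  change q _ = q _
  have indA : ∀ {p : A → Prop} (x : A) (zero : p 0) (mul : ∀ a b, p (a * b))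
      (add : ∀ x y, p x → p y → p (x + y)), p x :=
    fun x zero mul add => mul_induction (k := k) x zero mul add
  have indB : ∀ {p : B → Prop} (x : B) (zero : p 0) (mul : ∀ a b, p (a * b))
      (add : ∀ x y, p x → p y → p (x + y)), p x :=
    fun x zero mul add => mul_induction (k := k) x zero mul add
  have mv : ∀ u v w : A ⊗[k] B, q ((u * v) ⊗ₜ w) = q (u ⊗ₜ (v * w)) := relTensor_move
  induction y using indB with
  | zero => simp
  | add d d' h h' => simp only [mul_add, TensorProduct.tmul_add, map_add, h, h']
  | mul y w =>
    induction d using indA with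
    | zero => simp
    | add y y' h h' => simp only [TensorProduct.tmul_add, TensorProduct.add_tmul, map_add, h, h']
    | mul d e =>
      induction e using indA with
      | zero => simp
      | add z z' h h' =>
        simp only [mul_add, TensorProduct.tmul_add, TensorProduct.add_tmul, map_add, h, h']
      | mul e f =>
        have h1 := mv (a ⊗ₜ (x * z)) ((d * e) ⊗ₜ y) (f ⊗ₜ w)
        have h2 := mv (a ⊗ₜ x) ((d * e) ⊗ₜ (z * y)) (f ⊗ₜ w)
        simp only [Algebra.TensorProduct.tmul_mul_tmul] at h1 h2
        rw [← mul_assoc d e f, ← h1, ← mul_assoc z y w, ← h2, mul_assoc x z y]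

/-- The map `A ⊗_A A → (B ⊗_B B → (A ⊗ B) ⊗_{A ⊗ B} (A ⊗ B))`. -/
theorem exists_relTensor_map [IsUnitalAlgebra k A] [IsUnitalAlgebra k B] :
    ∃ g : A ⊗[k] B →ₗ[k] RelTensor (NonUnitalAlgHom.lmul k (A ⊗[k] B)), ∀ (a c : A) (x y : B),
      g ((a * c) ⊗ₜ (x * y)) = Submodule.Quotient.mk ((a ⊗ₜ x) ⊗ₜ (c ⊗ₜ y)) := by
  let q := (balancing (NonUnitalAlgHom.lmul k (A ⊗[k] B))).mkQ
  let eA := LinearEquiv.ofBijective _ (IsUnitalAlgebra.unital (k := k) (A := A))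
  let eB := LinearEquiv.ofBijective _ (IsUnitalAlgebra.unital (k := k) (A := B))
  -- the map `(a ⊗ c) ↦ (x ⊗ y) ↦ (a ⊗ x) ⊗ (c ⊗ y)`
  let φ : A ⊗[k] A →ₗ[k] B ⊗[k] B →ₗ[k] RelTensor (NonUnitalAlgHom.lmul k (A ⊗[k] B)) :=
    (TensorProduct.mk k (A ⊗[k] A) (B ⊗[k] B)).compr₂
      (q ∘ₗ (TensorProduct.tensorTensorTensorComm k A A B B).toLinearMap)
  have hφ : ∀ a c x y, φ (a ⊗ₜ c) (x ⊗ₜ y) = q ((a ⊗ₜ x) ⊗ₜ (c ⊗ₜ y)) := fun _ _ _ _ => rfl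
  have hA : balancing (NonUnitalAlgHom.lmul k A) ≤ LinearMap.ker φ := by
    refine Submodule.span_le.2 ?_
    rintro _ ⟨a, c, d, rfl⟩
    rw [SetLike.mem_coe, LinearMap.mem_ker, map_sub, sub_eq_zero]
    refine TensorProduct.ext' fun x y => ?_
    rw [hφ]
    exact relTensor_move_left a c d x y
  let ψ := ((balancing (NonUnitalAlgHom.lmul k A)).liftQ φ hA).flip
  let ψ' : B ⊗[k] B →ₗ[k] _ := φ.flip
  have hB : balancing (NonUnitalAlgHom.lmul k B) ≤ LinearMap.ker ψ' := by
    refine Submodule.span_le.2 ?_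
    rintro _ ⟨x, z, y, rfl⟩
    rw [SetLike.mem_coe, LinearMap.mem_ker, map_sub, sub_eq_zero]
    refine TensorProduct.ext' fun a d => ?_
    exact relTensor_move_right a d x z y
  have hB' : balancing (NonUnitalAlgHom.lmul k B) ≤ LinearMap.ker ψ := by
    intro t ht
    have := hB ht
    rw [LinearMap.mem_ker] at this ⊢
    refine LinearMap.ext fun s => ?_
    obtain ⟨s, rfl⟩ := Submodule.Quotient.mk_surjective _ s
    exact LinearMap.congr_fun this s
  let χ := (balancing (NonUnitalAlgHom.lmul k B)).liftQ ψ hB'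
  refine ⟨TensorProduct.lift ((χ.flip ∘ₗ eA.symm.toLinearMap).compl₂ eB.symm.toLinearMap),
    fun a c x y => ?_⟩
  have h1 : eA.symm (a * c) = Submodule.Quotient.mk (a ⊗ₜ c) := by
    rw [LinearEquiv.symm_apply_eq]; rfl
  have h2 : eB.symm (x * y) = Submodule.Quotient.mk (x ⊗ₜ y) := by
    rw [LinearEquiv.symm_apply_eq]; rfl
  simp only [TensorProduct.lift.tmul, LinearMap.compl₂_apply, LinearMap.comp_apply,
    LinearEquiv.coe_coe, h1, h2]
  rfl

instance IsUnitalAlgebra.tensor [IsUnitalAlgebra k A] [IsUnitalAlgebra k B] :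
    IsUnitalAlgebra k (A ⊗[k] B) where
  unital := by
    have indA : ∀ {p : A → Prop} (x : A) (zero : p 0) (mul : ∀ a b, p (a * b))
        (add : ∀ x y, p x → p y → p (x + y)), p x :=
      fun x zero mul add => mul_induction (k := k) x zero mul add
    have indB : ∀ {p : B → Prop} (x : B) (zero : p 0) (mul : ∀ a b, p (a * b))
        (add : ∀ x y, p x → p y → p (x + y)), p x :=
      fun x zero mul add => mul_induction (k := k) x zero mul add
    obtain ⟨g, hg⟩ := exists_relTensor_map (k := k) (A := A) (B := B)
    constructor
    · refine Function.LeftInverse.injective (g := g) fun t => ?_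
      obtain ⟨t, rfl⟩ := Submodule.Quotient.mk_surjective _ t
      suffices h : g ∘ₗ actMap (NonUnitalAlgHom.lmul k (A ⊗[k] B))
          = (balancing (NonUnitalAlgHom.lmul k (A ⊗[k] B))).mkQ from LinearMap.congr_fun h t
      refine TensorProduct.ext_fourfold' fun a x c y => ?_
      change g ((a ⊗ₜ x) * (c ⊗ₜ y)) = _
      rw [Algebra.TensorProduct.tmul_mul_tmul]
      exact hg a c x y
    · intro t
      induction t with
      | zero => exact ⟨0, map_zero _⟩
      | add x y hx hy =>
        obtain ⟨x, rfl⟩ := hx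
        obtain ⟨y, rfl⟩ := hy
        exact ⟨x + y, map_add _ _ _⟩
      | tmul a x =>
        induction a using indA with
        | zero => exact ⟨0, by simp⟩
        | add a a' h h' =>
          obtain ⟨s, hs⟩ := h
          obtain ⟨s', hs'⟩ := h'
          exact ⟨s + s', by rw [map_add, hs, hs', TensorProduct.add_tmul]⟩
        | mul a c =>
          induction x using indB with
          | zero => exact ⟨0, by simp⟩
          | add a a' h h' =>
            obtain ⟨s, hs⟩ := h
            obtain ⟨s', hs'⟩ := h'
            exact ⟨s + s', by rw [map_add, hs, hs', TensorProduct.tmul_add]⟩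
          | mul x y =>
            exact ⟨Submodule.Quotient.mk ((a ⊗ₜ x) ⊗ₜ (c ⊗ₜ y)),
              Algebra.TensorProduct.tmul_mul_tmul a c x y⟩

end Tensor

/-! ### `G`-module algebras and smash products -/

section Smash

/-- A `G`-module algebra structure on `A`: an action of `G` by `k`-algebra automorphisms. -/
structure AlgAction (k G A : Type u) [CommRing k] [Group G] [NonUnitalRing A] [Module k A] where
  rho : Representation k G A
  map_mul : ∀ (g : G) (a b : A), rho g (a * b) = rho g a * rho g b

variable {k G A B : Type u} [CommRing k] [Group G]
  [NonUnitalRing A] [Module k A] [IsScalarTower k A A] [SMulCommClass k A A]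
  [NonUnitalRing B] [Module k B] [IsScalarTower k B B] [SMulCommClass k B B]

/-- The diagonal action `g(a ⊗ b) = ga ⊗ gb` on `A ⊗ B`. -/
def AlgAction.tensor (α : AlgAction k G A) (β : AlgAction k G B) :
    AlgAction k G (A ⊗[k] B) where
  rho := Representation.tprod α.rho β.rho
  map_mul g x y := by
    induction x with
    | zero => simp
    | add x x' hx hx' => rw [add_mul, map_add, hx, hx', map_add, add_mul]
    | tmul a b =>
      induction y with
      | zero => simp
      | add y y' hy hy' => rw [mul_add, map_add, hy, hy', map_add, mul_add]
      | tmul c d => simp [α.map_mul, β.map_mul]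

/-- The smash product `A # kG`, with elements the finite sums `∑ a_g # g`. -/
def Smash (_ : AlgAction k G A) : Type u := G →₀ A

namespace Smash

variable (α : AlgAction k G A)

instance : AddCommGroup (Smash α) := inferInstanceAs (AddCommGroup (G →₀ A))
instance : Module k (Smash α) := inferInstanceAs (Module k (G →₀ A))

/-- `of α g a` is the element `a # g` of the smash product. -/
def of (g : G) : A →ₗ[k] Smash α := (Finsupp.lsingle g : A →ₗ[k] (G →₀ A))

/-- Left multiplication by `a # g`, `b # h ↦ a(gb) # gh`. -/
def mulOf (g : G) : A →ₗ[k] Smash α →ₗ[k] Smash α :=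
  LinearMap.flip (Finsupp.lsum k fun h => LinearMap.flip
    (((LinearMap.mul k A).compl₂ (α.rho g)).compr₂ (of α (g * h))))

/-- The product of the smash product as a bilinear map, `(a # g)(b # h) = a(gb) # gh`. -/
def mulLin : Smash α →ₗ[k] Smash α →ₗ[k] Smash α :=
  Finsupp.lsum k fun g => mulOf α g

instance : Mul (Smash α) := ⟨fun x y => mulLin α x y⟩

theorem of_mul_of (g h : G) (a b : A) :
    of α g a * of α h b = of α (g * h) (a * α.rho g b) := by
  have h1 : mulLin α (of α g a) = mulOf α g a := Finsupp.lsum_single k _ g a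
  have h2 : mulOf α g a (of α h b) = of α (g * h) (a * α.rho g b) :=
    LinearMap.congr_fun (Finsupp.lsum_single k (fun h => LinearMap.flip
      (((LinearMap.mul k A).compl₂ (α.rho g)).compr₂ (of α (g * h)))) h b) a
  exact (LinearMap.congr_fun h1 _).trans h2

set_option linter.unusedSectionVars false in
theorem induction {p : Smash α → Prop} (x : Smash α) (zero : p 0)
    (add : ∀ x y, p x → p y → p (x + y)) (of : ∀ g a, p (of α g a)) : p x :=
  Finsupp.induction_linear (motive := p) x zero add of

theorem left_distrib' (x y z : Smash α) : x * (y + z) = x * y + x * z :=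
  map_add (mulLin α x) y z

theorem right_distrib' (x y z : Smash α) : (x + y) * z = x * z + y * z :=
  LinearMap.map_add₂ (mulLin α) x y z

instance : NonUnitalRing (Smash α) where
  __ := (inferInstance : AddCommGroup (Smash α))
  left_distrib := left_distrib' α
  right_distrib := right_distrib' α
  zero_mul x := LinearMap.map_zero₂ (mulLin α) x
  mul_zero x := map_zero (mulLin α x)
  mul_assoc x y z := by
    have zm : ∀ x : Smash α, 0 * x = 0 := fun x => LinearMap.map_zero₂ (mulLin α) x
    have mz : ∀ x : Smash α, x * 0 = 0 := fun x => map_zero (mulLin α x)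
    induction x using Smash.induction with
    | zero => simp only [zm]
    | add x x' h h' => simp only [right_distrib', h, h']
    | of g a =>
      induction y using Smash.induction with
      | zero => simp only [zm, mz]
      | add x x' h h' => simp only [left_distrib', right_distrib', h, h']
      | of h b =>
        induction z using Smash.induction with
        | zero => simp only [mz]
        | add x x' h h' => simp only [left_distrib', h, h']
        | of l c => simp [of_mul_of, α.map_mul, mul_assoc]

instance : IsScalarTower k (Smash α) (Smash α) :=
  ⟨fun c x y => LinearMap.map_smul₂ (mulLin α) c x y⟩

instance : SMulCommClass k (Smash α) (Smash α) :=
  ⟨fun c x y => ((mulLin α x).map_smul c y).symm⟩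

/-- The algebra map `A → A # kG`, `a ↦ a # 1`. -/
def incl : A →ₙₐ[k] Smash α where
  toFun := of α 1
  map_smul' := (of α 1).map_smul
  map_zero' := (of α 1).map_zero
  map_add' := (of α 1).map_add
  map_mul' a b := by simp [of_mul_of]

end Smash

end Smash

/-! ### Graded algebras and the cotensor product -/

section Graded

/-- A family of submodules `S_g` of an algebra `S` with `1 ∈ S_e` and `S_g S_h ⊆ S_{gh}`. -/
structure Grading (k G S : Type u) [CommRing k] [Group G] [Ring S] [Algebra k S] where
  part : G → Submodule k S
  one_mem : (1 : S) ∈ part 1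
  mul_mem : ∀ {g h : G} {s t : S}, s ∈ part g → t ∈ part h → s * t ∈ part (g * h)

variable {k G S T : Type u} [CommRing k] [Group G]
  [Ring S] [Algebra k S] [Ring T] [Algebra k T]

open scoped Classical in
/-- `S`, with the submodules `S_g`, is a graded algebra: `S = ⨁ S_g`. -/
def Grading.IsGraded (𝒮 : Grading k G S) : Prop := DirectSum.IsInternal 𝒮.part

/-- The product `S_g × S_h → S_{gh}`. -/
def Grading.mulPart (𝒮 : Grading k G S) (g h : G) :
    𝒮.part g →ₗ[k] 𝒮.part h →ₗ[k] 𝒮.part (g * h) :=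
  LinearMap.mk₂ k (fun s t => ⟨s.1 * t.1, 𝒮.mul_mem s.2 t.2⟩)
    (fun _ _ _ => Subtype.ext (add_mul _ _ _)) (fun _ _ _ => Subtype.ext (smul_mul_assoc _ _ _))
    (fun _ _ _ => Subtype.ext (mul_add _ _ _)) (fun _ _ _ => Subtype.ext (mul_smul_comm _ _ _))

/-- The cotensor product `S □ T = ⨁ S_g ⊗ T_g`. -/
def Cotensor (𝒮 : Grading k G S) (𝒯 : Grading k G T) : Type u :=
  ⨁ g : G, (𝒮.part g ⊗[k] 𝒯.part g)

namespace Cotensor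

variable (𝒮 : Grading k G S) (𝒯 : Grading k G T)

instance : AddCommGroup (Cotensor 𝒮 𝒯) :=
  Module.addCommMonoidToAddCommGroup k (M := ⨁ g : G, (𝒮.part g ⊗[k] 𝒯.part g))
instance : Module k (Cotensor 𝒮 𝒯) :=
  inferInstanceAs (Module k (⨁ g : G, (𝒮.part g ⊗[k] 𝒯.part g)))

open scoped Classical in
/-- The inclusion of `S_g ⊗ T_g`. -/
def of (g : G) : 𝒮.part g ⊗[k] 𝒯.part g →ₗ[k] Cotensor 𝒮 𝒯 :=
  DirectSum.lof k G (fun g => 𝒮.part g ⊗[k] 𝒯.part g) g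

/-- The element `s ⊗ t` of `S □ T`, for `s ∈ S_g` and `t ∈ T_g`. -/
def tmul (g : G) (s : S) (hs : s ∈ 𝒮.part g) (t : T) (ht : t ∈ 𝒯.part g) : Cotensor 𝒮 𝒯 :=
  of 𝒮 𝒯 g (⟨s, hs⟩ ⊗ₜ ⟨t, ht⟩)

open scoped Classical in
/-- Left multiplication by `x ∈ S_g ⊗ T_g`. -/
def mulOf (g : G) : 𝒮.part g ⊗[k] 𝒯.part g →ₗ[k] Cotensor 𝒮 𝒯 →ₗ[k] Cotensor 𝒮 𝒯 :=
  LinearMap.flip <| DirectSum.toModule k G _ fun h => LinearMap.flip <|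
    (TensorProduct.map₂ (𝒮.mulPart g h) (𝒯.mulPart g h)).compr₂ (of 𝒮 𝒯 (g * h))

open scoped Classical in
/-- The product of `S □ T` as a bilinear map, `(s ⊗ t)(s' ⊗ t') = ss' ⊗ tt'`. -/
def mulLin : Cotensor 𝒮 𝒯 →ₗ[k] Cotensor 𝒮 𝒯 →ₗ[k] Cotensor 𝒮 𝒯 :=
  DirectSum.toModule k G _ fun g => mulOf 𝒮 𝒯 g

instance : Mul (Cotensor 𝒮 𝒯) := ⟨fun x y => mulLin 𝒮 𝒯 x y⟩

instance : One (Cotensor 𝒮 𝒯) := ⟨tmul 𝒮 𝒯 1 1 𝒮.one_mem 1 𝒯.one_mem⟩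

open scoped Classical in
theorem of_mul_of (g h : G) (x : 𝒮.part g ⊗[k] 𝒯.part g) (y : 𝒮.part h ⊗[k] 𝒯.part h) :
    of 𝒮 𝒯 g x * of 𝒮 𝒯 h y =
      of 𝒮 𝒯 (g * h) (TensorProduct.map₂ (𝒮.mulPart g h) (𝒯.mulPart g h) x y) := by
  have h1 : mulLin 𝒮 𝒯 (of 𝒮 𝒯 g x) = mulOf 𝒮 𝒯 g x :=
    DirectSum.toModule_lof (M := fun g : G => 𝒮.part g ⊗[k] 𝒯.part g)
      (φ := fun g => mulOf 𝒮 𝒯 g) k g x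
  have h2 : mulOf 𝒮 𝒯 g x (of 𝒮 𝒯 h y) =
      of 𝒮 𝒯 (g * h) (TensorProduct.map₂ (𝒮.mulPart g h) (𝒯.mulPart g h) x y) :=
    LinearMap.congr_fun (DirectSum.toModule_lof
      (M := fun h : G => 𝒮.part h ⊗[k] 𝒯.part h) (φ := fun h => LinearMap.flip <|
      (TensorProduct.map₂ (𝒮.mulPart g h) (𝒯.mulPart g h)).compr₂ (of 𝒮 𝒯 (g * h))) k h y) x
  exact (LinearMap.congr_fun h1 _).trans h2

theorem tmul_mul_tmul (g h : G) (s s' : S) (hs : s ∈ 𝒮.part g) (hs' : s' ∈ 𝒮.part h)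
    (t t' : T) (ht : t ∈ 𝒯.part g) (ht' : t' ∈ 𝒯.part h) :
    tmul 𝒮 𝒯 g s hs t ht * tmul 𝒮 𝒯 h s' hs' t' ht' =
      tmul 𝒮 𝒯 (g * h) (s * s') (𝒮.mul_mem hs hs') (t * t') (𝒯.mul_mem ht ht') :=
  of_mul_of 𝒮 𝒯 g h _ _

theorem tmul_congr {g g' : G} {s s' : S} {t t' : T} {hs : s ∈ 𝒮.part g} {ht : t ∈ 𝒯.part g}
    {hs' : s' ∈ 𝒮.part g'} {ht' : t' ∈ 𝒯.part g'} (hg : g = g') (h : s = s') (h' : t = t') :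
    tmul 𝒮 𝒯 g s hs t ht = tmul 𝒮 𝒯 g' s' hs' t' ht' := by
  subst hg h h'; rfl

theorem induction {p : Cotensor 𝒮 𝒯 → Prop} (x : Cotensor 𝒮 𝒯) (zero : p 0)
    (add : ∀ x y, p x → p y → p (x + y)) (tmul : ∀ g s hs t ht, p (tmul 𝒮 𝒯 g s hs t ht)) :
    p x := by
  classical
  refine DirectSum.induction_on (motive := p) x zero (fun g x => ?_) add
  change p (of 𝒮 𝒯 g x)
  induction x with
  | zero => rw [map_zero]; exact zero
  | add x y hx hy => rw [map_add]; exact add _ _ hx hy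
  | tmul s t => exact tmul g s.1 s.2 t.1 t.2

theorem left_distrib' (x y z : Cotensor 𝒮 𝒯) : x * (y + z) = x * y + x * z :=
  map_add (mulLin 𝒮 𝒯 x) y z

theorem right_distrib' (x y z : Cotensor 𝒮 𝒯) : (x + y) * z = x * z + y * z :=
  LinearMap.map_add₂ (mulLin 𝒮 𝒯) x y z

theorem zero_mul' (x : Cotensor 𝒮 𝒯) : 0 * x = 0 := LinearMap.map_zero₂ (mulLin 𝒮 𝒯) x

theorem mul_zero' (x : Cotensor 𝒮 𝒯) : x * 0 = 0 := map_zero (mulLin 𝒮 𝒯 x)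

theorem one_def : (1 : Cotensor 𝒮 𝒯) = tmul 𝒮 𝒯 1 1 𝒮.one_mem 1 𝒯.one_mem := rfl

instance : Ring (Cotensor 𝒮 𝒯) where
  __ := (inferInstance : AddCommGroup (Cotensor 𝒮 𝒯))
  left_distrib := left_distrib' 𝒮 𝒯
  right_distrib := right_distrib' 𝒮 𝒯
  zero_mul := zero_mul' 𝒮 𝒯
  mul_zero := mul_zero' 𝒮 𝒯
  mul_assoc x y z := by
    induction x using Cotensor.induction with
    | zero => simp only [zero_mul']
    | add x x' h h' => simp only [right_distrib', h, h']
    | tmul g s hs t ht =>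
      induction y using Cotensor.induction with
      | zero => simp only [zero_mul', mul_zero']
      | add x x' h h' => simp only [left_distrib', right_distrib', h, h']
      | tmul g s hs t ht =>
        induction z using Cotensor.induction with
        | zero => simp only [mul_zero']
        | add x x' h h' => simp only [left_distrib', h, h']
        | tmul g s hs t ht =>
          simp only [tmul_mul_tmul]
          exact tmul_congr _ _ (mul_assoc _ _ _) (mul_assoc _ _ _) (mul_assoc _ _ _)
  one_mul x := by
    induction x using Cotensor.induction with
    | zero => exact mul_zero' _ _ _
    | add x x' h h' => rw [left_distrib', h, h']
    | tmul g s hs t ht =>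
      rw [one_def, tmul_mul_tmul]
      exact tmul_congr _ _ (one_mul _) (one_mul _) (one_mul _)
  mul_one x := by
    induction x using Cotensor.induction with
    | zero => exact zero_mul' _ _ _
    | add x x' h h' => rw [right_distrib', h, h']
    | tmul g s hs t ht =>
      rw [one_def, tmul_mul_tmul]
      exact tmul_congr _ _ (mul_one _) (mul_one _) (mul_one _)
  neg_add_cancel x := neg_add_cancel x
  zsmul := (· • ·)
  zsmul_zero' := zero_zsmul
  zsmul_succ' := fun n a => by simp [add_zsmul]
  zsmul_neg' := fun n a => by simp [add_zsmul, Int.negSucc_eq]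

instance : Algebra k (Cotensor 𝒮 𝒯) :=
  Algebra.ofModule (fun c x y => LinearMap.map_smul₂ (mulLin 𝒮 𝒯) c x y)
    (fun c x y => (mulLin 𝒮 𝒯 x).map_smul c y)

/-- The grading of `S □ T`: the part of degree `g` is `S_g ⊗ T_g`. -/
def grading : Grading k G (Cotensor 𝒮 𝒯) where
  part g := LinearMap.range (of 𝒮 𝒯 g)
  one_mem := ⟨_, rfl⟩
  mul_mem := by
    rintro g h _ _ ⟨x, rfl⟩ ⟨y, rfl⟩
    exact ⟨_, (of_mul_of 𝒮 𝒯 g h x y).symm⟩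

end Cotensor

end Graded

/-! ### The graded algebra `Hom_{Aᵉ}(A, A # kG)` -/

section Hom

variable {k G A : Type u} [CommRing k] [Group G]
  [NonUnitalRing A] [Module k A] [IsScalarTower k A A] [SMulCommClass k A A]

/-- `Hom_{Aᵉ}(A, A # kG)`. -/
abbrev SmashHom (α : AlgAction k G A) : Type u := EnvHom (Smash.incl α)

/-- The grading of `Hom_{Aᵉ}(A, A # kG)`: a homomorphism `f` is of degree `g` if `f(A) ⊆ A # g`. -/
def smashHomGrading [IsUnitalAlgebra k A] (α : AlgAction k G A) :
    Grading k G (SmashHom α) where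
  part g := {
    carrier := {f | ∀ a : A, f.1 a ∈ LinearMap.range (Smash.of α g)}
    add_mem' := fun hf hg a => add_mem (hf a) (hg a)
    zero_mem' := fun _ => zero_mem _
    smul_mem' := fun c _ hf a => Submodule.smul_mem _ c (hf a) }
  one_mem a := ⟨a, rfl⟩
  mul_mem {g h φ ψ} hφ hψ x := by
    have indA : ∀ {p : A → Prop} (x : A) (zero : p 0) (mul : ∀ a b, p (a * b))
        (add : ∀ x y, p x → p y → p (x + y)), p x :=
      fun x zero mul add => mul_induction (k := k) x zero mul add
    induction x using indA with
    | zero => rw [map_zero]; exact zero_mem _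
    | add x y hx hy => rw [map_add]; exact add_mem hx hy
    | mul a b =>
      obtain ⟨u, hu⟩ := hφ a
      obtain ⟨v, hv⟩ := hψ b
      rw [EnvHom.mul_apply, ← hu, ← hv, Smash.of_mul_of]
      exact ⟨_, rfl⟩

end Hom

/-- An isomorphism of `G`-graded algebras. -/
structure GradedAlgEquiv {k G S T : Type u} [CommRing k] [Group G]
    [Ring S] [Algebra k S] [Ring T] [Algebra k T]
    (𝒮 : Grading k G S) (𝒯 : Grading k G T) extends S ≃ₐ[k] T where
  map_part : ∀ (g : G) (s : S), s ∈ 𝒮.part g ↔ toFun s ∈ 𝒯.part g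

end TaylorAzumaya

end

/-! Write $S_g$ and $T_g$ for the parts of degree $g$ of ${\rm Hom}_{A^{\rm e}}(A,A\# kG)$ and ${\rm
Hom}_{B^{\rm e}}(B,B\# kG)$. As an $A^{\rm e}$-module, $A\# g$ is $A$ with the right action twisted
by $g$, so $A\# kG$ is a unital module (`isUnitalModule_smash`) and the counit is an isomorphism
there. Restricted to degree $g$ it gives $A\otimes S_g\cong A\# g$ (`SmashHom.eval_bijective`), and
likewise for $B$.

Tensoring these, $(A\otimes B)\otimes(S_g\otimes T_g)\cong(A\otimes B)\# g$ as $(A\otimes B)^{\rm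
e}$-modules, and summing over $g$ gives $(A\otimes B)\otimes\bigoplus_g(S_g\otimes
T_g)\cong(A\otimes B)\# kG$. Now apply ${\rm Hom}_{(A\otimes B)^{\rm e}}(A\otimes B,-)$. The unit of
the adjunction for $A\otimes B$ is bijective (`unitMap_tensor_bijective`), so the left side becomes
$\bigoplus_g S_g\otimes T_g$, the cotensor product. The counit for $A\otimes B$ is not needed.

The passage from isomorphisms $C\otimes N_g\cong C\# g$ to $\bigoplus_g N_g\cong{\rm Hom}_{C^{\rm
e}}(C,C\# kG)$ is `exists_directSum_equiv_smashHom`. It also yields the grading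
(`isGraded_of_equiv`): a homomorphism comes from an element of a direct sum, hence has only finitely
many nonzero homogeneous components. That the isomorphism is multiplicative is read off from its
values on pure tensors.

In place of a unit element, identities are tested on products of two or three elements, which span a
unital algebra. -/

noncomputable section

namespace TaylorAzumaya

/-! ### Unital algebras: maps determined by products, and moving factors in $A^{\rm
e}\otimes_{A^{\rm e}}S$. -/

section Unital

variable {k A : Type u} [CommRing k]
  [NonUnitalRing A] [Module k A] [IsScalarTower k A A] [SMulCommClass k A A]

/-- Balanced bilinear maps out of a unital algebra factor through the multiplication. -/
theorem exists_lift_mul [IsUnitalAlgebra k A] {M : Type u} [AddCommGroup M] [Module k M]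
    (f : A →ₗ[k] A →ₗ[k] M) (hf : ∀ a b c, f (a * b) c = f a (b * c)) :
    ∃ F : A →ₗ[k] M, ∀ a b, F (a * b) = f a b := by
  let e := LinearEquiv.ofBijective _ (IsUnitalAlgebra.unital (k := k) (A := A))
  have h : balancing (NonUnitalAlgHom.lmul k A) ≤ LinearMap.ker (TensorProduct.lift f) := by
    refine Submodule.span_le.2 ?_
    rintro _ ⟨a, b, c, rfl⟩
    simp [hf]
  refine ⟨(balancing (NonUnitalAlgHom.lmul k A)).liftQ _ h ∘ₗ e.symm.toLinearMap, fun a b => ?_⟩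
  have he : e.symm (a * b) = Submodule.Quotient.mk (a ⊗ₜ b) := by
    rw [LinearEquiv.symm_apply_eq]; rfl
  simp only [LinearMap.comp_apply, LinearEquiv.coe_coe, he]
  rfl

/-- Two linear maps out of a unital algebra that agree on products of three elements are equal. -/
theorem ext_on_mul_mul [IsUnitalAlgebra k A] {M : Type u} [AddCommGroup M] [Module k M]
    {f g : A →ₗ[k] M} (h : ∀ a b c, f (a * (b * c)) = g (a * (b * c))) : f = g := by
  refine ext_on_mul fun a b => ?_
  have : f ∘ₗ LinearMap.mulLeft k a = g ∘ₗ LinearMap.mulLeft k a :=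
    ext_on_mul fun b c => by simpa using h a b c
  simpa using LinearMap.congr_fun this b

variable {S : Type u} [NonUnitalRing S] [Module k S] [IsScalarTower k S S] [SMulCommClass k S S]

/-- In `Aᵉ ⊗_{Aᵉ} S` left factors may be moved across the tensor sign. -/
theorem envAct_move_left [IsUnitalAlgebra k A] (η : A →ₙₐ[k] S) (x y c : A) (s : S) :
    (balancing (envAct η)).mkQ (((x * y) ⊗ₜ MulOpposite.op c) ⊗ₜ s)
      = (balancing (envAct η)).mkQ ((x ⊗ₜ MulOpposite.op c) ⊗ₜ (η y * s)) := by
  have mv : ∀ r r' s, (balancing (envAct η)).mkQ ((r * r') ⊗ₜ s)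
      = (balancing (envAct η)).mkQ (r ⊗ₜ (envAct η r' s)) := fun r r' s =>
    (Submodule.Quotient.eq _).2 (Submodule.subset_span ⟨r, r', s, rfl⟩)
  refine mul_induction (k := k) x (by simp) (fun x₁ x₂ => ?_)
    (fun x x' h h' => by simp only [add_mul, TensorProduct.add_tmul, map_add, h, h'])
  refine mul_induction (k := k) c (by simp) (fun c₁ c₂ => ?_)
    (fun x x' h h' => by
      simp only [MulOpposite.op_add, TensorProduct.add_tmul, TensorProduct.tmul_add, map_add, h, h'])
  -- Moving $y$ alone would need $y\otimes1\in A^{\rm e}$. Instead $x=x_1x_2$ and $c=c_1c_2$ are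
  -- split: $x_2y\otimes c_1$ crosses the tensor sign, and $x_2\otimes c_1$ crosses back.
  have h1 := mv (x₁ ⊗ₜ MulOpposite.op c₂) ((x₂ * y) ⊗ₜ MulOpposite.op c₁) s
  have h2 := mv (x₁ ⊗ₜ MulOpposite.op c₂) (x₂ ⊗ₜ MulOpposite.op c₁) (η y * s)
  simp only [Algebra.TensorProduct.tmul_mul_tmul, ← MulOpposite.op_mul, envAct_tmul,
    MulOpposite.unop_op, map_mul] at h1 h2
  rw [mul_assoc x₁, h1, h2]
  simp only [mul_assoc]

/-- In `Aᵉ ⊗_{Aᵉ} S` right factors may be moved across the tensor sign. -/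
theorem envAct_move_right [IsUnitalAlgebra k A] (η : A →ₙₐ[k] S) (x y c : A) (s : S) :
    (balancing (envAct η)).mkQ ((x ⊗ₜ MulOpposite.op (y * c)) ⊗ₜ s)
      = (balancing (envAct η)).mkQ ((x ⊗ₜ MulOpposite.op c) ⊗ₜ (s * η y)) := by
  have mv : ∀ r r' s, (balancing (envAct η)).mkQ ((r * r') ⊗ₜ s)
      = (balancing (envAct η)).mkQ (r ⊗ₜ (envAct η r' s)) := fun r r' s =>
    (Submodule.Quotient.eq _).2 (Submodule.subset_span ⟨r, r', s, rfl⟩)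
  refine mul_induction (k := k) x (by simp) (fun x₁ x₂ => ?_)
    (fun x x' h h' => by simp only [TensorProduct.add_tmul, map_add, h, h'])
  refine mul_induction (k := k) c (by simp) (fun c₁ c₂ => ?_)
    (fun x x' h h' => by
      simp only [mul_add, MulOpposite.op_add, TensorProduct.add_tmul, TensorProduct.tmul_add,
        map_add, h, h'])
  have h1 := mv (x₁ ⊗ₜ MulOpposite.op c₂) (x₂ ⊗ₜ MulOpposite.op (y * c₁)) s
  have h2 := mv (x₁ ⊗ₜ MulOpposite.op c₂) (x₂ ⊗ₜ MulOpposite.op c₁) (s * η y)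
  simp only [Algebra.TensorProduct.tmul_mul_tmul, ← MulOpposite.op_mul, envAct_tmul,
    MulOpposite.unop_op, map_mul] at h1 h2
  rw [← mul_assoc y, h1, h2]
  simp only [mul_assoc]

end Unital

/-! ### The smash product as a unital $A^{\rm e}$-module. -/

section SmashUnital

variable {k G A : Type u} [CommRing k] [Group G]
  [NonUnitalRing A] [Module k A] [IsScalarTower k A A] [SMulCommClass k A A]

theorem Smash.incl_apply (α : AlgAction k G A) (a : A) : Smash.incl α a = Smash.of α 1 a := rfl

theorem Smash.incl_mul_of (α : AlgAction k G A) (g : G) (a b : A) :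
    Smash.incl α a * Smash.of α g b = Smash.of α g (a * b) := by
  simp [Smash.incl_apply, Smash.of_mul_of]

theorem Smash.of_mul_incl (α : AlgAction k G A) (g : G) (a b : A) :
    Smash.of α g b * Smash.incl α a = Smash.of α g (b * α.rho g a) := by
  simp [Smash.incl_apply, Smash.of_mul_of]

set_option linter.unusedSectionVars false in
theorem AlgAction.rho_rho_inv (α : AlgAction k G A) (g : G) (a : A) :
    α.rho g (α.rho g⁻¹ a) = a := by
  rw [← Module.End.mul_apply, ← _root_.map_mul, mul_inv_cancel, _root_.map_one, Module.End.one_apply]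

set_option linter.unusedSectionVars false in
theorem AlgAction.rho_inv_rho (α : AlgAction k G A) (g : G) (a : A) :
    α.rho g⁻¹ (α.rho g a) = a := by
  rw [← Module.End.mul_apply, ← _root_.map_mul, inv_mul_cancel, _root_.map_one, Module.End.one_apply]

/-- The inverse of `Aᵉ ⊗_{Aᵉ} (A # g) → A # g`, `abc # g ↦ (a ⊗ g⁻¹c) ⊗ (b # g)`. -/
theorem exists_relTensor_smash [IsUnitalAlgebra k A] (α : AlgAction k G A) (g : G) :
    ∃ F : A →ₗ[k] RelTensor (envAct (Smash.incl α)), ∀ x b c : A,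
      F (x * (b * α.rho g c)) = (balancing (envAct (Smash.incl α))).mkQ
        ((x ⊗ₜ MulOpposite.op c) ⊗ₜ Smash.of α g b) := by
  let q := (balancing (envAct (Smash.incl α))).mkQ
  -- The value at $b,c,x$ represents $xbc\# g$. Right multiplication of $A\# g$ by $c'$ is right
  -- multiplication by $g\cdot c'$ on coefficients, so $c$ enters as $g^{-1}\cdot c$.
  let f : A →ₗ[k] A →ₗ[k] A →ₗ[k] RelTensor (envAct (Smash.incl α)) :=
    LinearMap.mk₂ k
      (fun b c => q ∘ₗ (TensorProduct.mk k (A ⊗[k] Aᵐᵒᵖ) (Smash α)).flip (Smash.of α g b) ∘ₗ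
        (TensorProduct.mk k A Aᵐᵒᵖ).flip (MulOpposite.op (α.rho g⁻¹ c)))
      (fun b b' c => by ext; simp)
      (fun r b c => by ext; simp)
      (fun b c c' => by ext; simp)
      (fun r b c => by ext; simp)
  have hf : ∀ b c x, f b c x = q ((x ⊗ₜ MulOpposite.op (α.rho g⁻¹ c)) ⊗ₜ Smash.of α g b) :=
    fun _ _ _ => rfl
  obtain ⟨H, hH⟩ := exists_lift_mul f (fun a b c => by
    refine LinearMap.ext fun x => ?_
    rw [hf, hf, α.map_mul, envAct_move_right, Smash.of_mul_incl, α.rho_rho_inv])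
  have hH' : ∀ b c x, H (b * c) x =
      q ((x ⊗ₜ MulOpposite.op (α.rho g⁻¹ c)) ⊗ₜ Smash.of α g b) := fun b c x => by rw [hH, hf]
  -- The product $bc$ is already absorbed in `H`; a second factorization absorbs $x$. Balancedness
  -- is tested with the last argument a product, where `H` is known.
  obtain ⟨F, hF⟩ := exists_lift_mul H.flip (fun a b c => by
    have : H.flip (a * b) = H.flip a ∘ₗ LinearMap.mulLeft k b := ext_on_mul fun c d => by
      simp only [LinearMap.flip_apply, LinearMap.comp_apply, LinearMap.mulLeft_apply]
      rw [← mul_assoc, hH', hH', ← Smash.incl_mul_of]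
      exact envAct_move_left _ _ _ _ _
    exact LinearMap.congr_fun this c)
  refine ⟨F, fun x b c => ?_⟩
  rw [hF, LinearMap.flip_apply, hH', α.rho_inv_rho]

/-- The smash product is a unital `Aᵉ`-module. -/
theorem isUnitalModule_smash [IsUnitalAlgebra k A] (α : AlgAction k G A) :
    IsUnitalModule (envAct (Smash.incl α)) := by
  choose F hF using exists_relTensor_smash α
  let T : Smash α →ₗ[k] RelTensor (envAct (Smash.incl α)) :=
    (Finsupp.lsum k F : (G →₀ A) →ₗ[k] _)
  have hT : ∀ g a, T (Smash.of α g a) = F g a := fun g a => Finsupp.lsum_single k F g a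
  constructor
  · refine Function.LeftInverse.injective (g := T) fun t => ?_
    obtain ⟨t, rfl⟩ := Submodule.Quotient.mk_surjective _ t
    suffices h : T ∘ₗ actMap (envAct (Smash.incl α)) = (balancing (envAct (Smash.incl α))).mkQ
      from LinearMap.congr_fun h t
    refine TensorProduct.ext_threefold fun a c s => ?_
    simp only [LinearMap.comp_apply, actMap_tmul, envAct_tmul]
    induction s using Smash.induction with
    | zero => simp
    | add x y hx hy => simp only [add_mul, mul_add, map_add, TensorProduct.tmul_add, hx, hy]
    | of g b =>
      rw [Smash.of_mul_incl, Smash.incl_mul_of, hT, hF, MulOpposite.op_unop]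
  · refine LinearMap.range_eq_top.1 (eq_top_iff.2 ?_)
    rintro s -
    induction s using Smash.induction with
    | zero => exact zero_mem _
    | add x y hx hy => exact add_mem hx hy
    | of g a =>
      let Q := LinearMap.range (relAct (envAct (Smash.incl α)))
      -- Modulo the image, surjectivity becomes an equality of linear maps on $A$. It can be tested
      -- on triple products, where $abc\# g=(a\otimes g^{-1}c)\cdot(b\# g)$.
      suffices h : Q.mkQ ∘ₗ Smash.of α g = 0 by
        simpa [Q] using LinearMap.congr_fun h a
      refine ext_on_mul_mul fun a b c => ?_
      simp only [LinearMap.comp_apply, LinearMap.zero_apply, Submodule.mkQ_apply,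
        Submodule.Quotient.mk_eq_zero]
      have h := actMap_tmul (envAct (Smash.incl α)) (a ⊗ₜ[k] MulOpposite.op (α.rho g⁻¹ c))
        (Smash.of α g b)
      rw [envAct_tmul, MulOpposite.unop_op, Smash.of_mul_incl, Smash.incl_mul_of,
        α.rho_rho_inv] at h
      exact ⟨(balancing (envAct (Smash.incl α))).mkQ
        ((a ⊗ₜ[k] MulOpposite.op (α.rho g⁻¹ c)) ⊗ₜ[k] Smash.of α g b), h⟩

end SmashUnital

/-! ### Coefficients in the smash product, and the counit degree by degree. -/

section Coefficients

variable {k G A : Type u} [CommRing k] [Group G]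
  [NonUnitalRing A] [Module k A] [IsScalarTower k A A] [SMulCommClass k A A]

/-- The coefficient of `g` in an element of the smash product. -/
def Smash.coef (α : AlgAction k G A) (g : G) : Smash α →ₗ[k] A :=
  (Finsupp.lapply g : (G →₀ A) →ₗ[k] A)

theorem Smash.coef_of (α : AlgAction k G A) (g : G) (a : A) :
    Smash.coef α g (Smash.of α g a) = a := Finsupp.single_eq_same

theorem Smash.coef_of_ne (α : AlgAction k G A) {g h : G} (hgh : g ≠ h) (a : A) :
    Smash.coef α h (Smash.of α g a) = 0 := Finsupp.single_eq_of_ne' hgh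

theorem Smash.ext_coef {α : AlgAction k G A} {s t : Smash α}
    (h : ∀ g, Smash.coef α g s = Smash.coef α g t) : s = t := Finsupp.ext h

theorem Smash.mem_range_of {α : AlgAction k G A} {g : G} {s : Smash α} :
    s ∈ LinearMap.range (Smash.of α g) ↔ Smash.of α g (Smash.coef α g s) = s :=
  ⟨by rintro ⟨a, rfl⟩; rw [Smash.coef_of], fun h => ⟨_, h⟩⟩

/-- With `Smash.coef_mul_incl`: $A\# kG$ is the direct sum of copies of the bimodule $A$ with right
action twisted by $g$. Hence cutting a homomorphism down to one degree keeps it $A^{\rm e}$-linear,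
as `SmashHom.proj` requires. -/
theorem Smash.coef_incl_mul (α : AlgAction k G A) (g : G) (a : A) (s : Smash α) :
    Smash.coef α g (Smash.incl α a * s) = a * Smash.coef α g s := by
  induction s using Smash.induction with
  | zero => simp
  | add x y hx hy => simp only [mul_add, map_add, hx, hy]
  | of h b =>
    rw [Smash.incl_mul_of]
    by_cases hgh : h = g
    · subst hgh; rw [Smash.coef_of, Smash.coef_of]
    · rw [Smash.coef_of_ne _ hgh, Smash.coef_of_ne _ hgh, mul_zero]

theorem Smash.coef_mul_incl (α : AlgAction k G A) (g : G) (a : A) (s : Smash α) :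
    Smash.coef α g (s * Smash.incl α a) = Smash.coef α g s * α.rho g a := by
  induction s using Smash.induction with
  | zero => simp
  | add x y hx hy => simp only [add_mul, map_add, hx, hy]
  | of h b =>
    rw [Smash.of_mul_incl]
    by_cases hgh : h = g
    · subst hgh; rw [Smash.coef_of, Smash.coef_of]
    · rw [Smash.coef_of_ne _ hgh, Smash.coef_of_ne _ hgh, zero_mul]

variable [IsUnitalAlgebra k A]

theorem mem_smashHomGrading_part {α : AlgAction k G A} {g : G} {φ : SmashHom α} :
    φ ∈ (smashHomGrading α).part g ↔ ∀ a, Smash.of α g (Smash.coef α g (φ.1 a)) = φ.1 a :=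
  forall_congr' fun _ => Smash.mem_range_of

/-- The projection of `Hom_{Aᵉ}(A, A # kG)` onto its part of degree `g`. -/
def SmashHom.proj (α : AlgAction k G A) (g : G) : SmashHom α →ₗ[k] (smashHomGrading α).part g where
  toFun φ := ⟨⟨Smash.of α g ∘ₗ Smash.coef α g ∘ₗ φ.1, EnvHom.mem_of_map_mul _
      (fun a b => by
        simp only [LinearMap.comp_apply]
        rw [EnvHom.map_mul_left, Smash.coef_incl_mul, Smash.incl_mul_of])
      (fun a b => by
        simp only [LinearMap.comp_apply]
        rw [EnvHom.map_mul_right, Smash.coef_mul_incl, Smash.of_mul_incl])⟩,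
    fun a => ⟨_, rfl⟩⟩
  map_add' φ ψ := by ext a; simp
  map_smul' c φ := by ext a; simp

theorem SmashHom.proj_apply (α : AlgAction k G A) (g : G) (φ : SmashHom α) (a : A) :
    (SmashHom.proj α g φ).1.1 a = Smash.of α g (Smash.coef α g (φ.1 a)) := rfl

/-- The map `A ⊗ Hom_{Aᵉ}(A, A # g) → A`, `a ⊗ φ ↦ b` where `φ(a) = b # g`. -/
def SmashHom.eval (α : AlgAction k G A) (g : G) :
    A ⊗[k] (smashHomGrading α).part g →ₗ[k] A :=
  Smash.coef α g ∘ₗ counitMap k A (envAct (Smash.incl α)) ∘ₗ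
    ((smashHomGrading α).part g).subtype.lTensor A

theorem SmashHom.eval_tmul (α : AlgAction k G A) (g : G) (a : A)
    (φ : (smashHomGrading α).part g) :
    SmashHom.eval α g (a ⊗ₜ φ) = Smash.coef α g (φ.1.1 a) := rfl

/-- Taking the coefficient of $g$ loses nothing on homomorphisms of degree $g$, so injectivity of
the counit passes to `SmashHom.eval`. -/
theorem SmashHom.of_eval (α : AlgAction k G A) (g : G) (t : A ⊗[k] (smashHomGrading α).part g) :
    Smash.of α g (SmashHom.eval α g t) = counitMap k A (envAct (Smash.incl α))
      (((smashHomGrading α).part g).subtype.lTensor A t) := by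
  induction t with
  | zero => simp
  | add x y hx hy => simp only [map_add, hx, hy]
  | tmul a φ =>
    rw [SmashHom.eval_tmul]
    exact mem_smashHomGrading_part.1 φ.2 a

end Coefficients

/-- The counit at $A\# kG$ is an isomorphism compatible with the projections to degree $g$ on both
sides, so it restricts to an isomorphism of these summands. -/
theorem SmashHom.eval_bijective {k G A : Type u} [CommRing k] [Group G]
    [NonUnitalRing A] [Module k A] [IsScalarTower k A A] [SMulCommClass k A A]
    [IsTaylorAzumaya k A] (α : AlgAction k G A) (g : G) :
    Function.Bijective (SmashHom.eval α g) := by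
  have hc := IsTaylorAzumaya.counit_bijective (k := k) (A := A) (Smash α) _
    (isUnitalModule_smash α)
  constructor
  -- No flatness of $A$ is needed: the inclusion of the part of degree $g$ is split by
  -- `SmashHom.proj`.
  · have h1 : Function.Injective (((smashHomGrading α).part g).subtype.lTensor A) := by
      refine Function.LeftInverse.injective (g := (SmashHom.proj α g).lTensor A) fun t => ?_
      rw [← LinearMap.comp_apply, ← LinearMap.lTensor_comp]
      have : SmashHom.proj α g ∘ₗ ((smashHomGrading α).part g).subtype = LinearMap.id := by
        refine LinearMap.ext fun φ => Subtype.ext (Subtype.ext (LinearMap.ext fun a => ?_))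
        exact mem_smashHomGrading_part.1 φ.2 a
      rw [this, LinearMap.lTensor_id, LinearMap.id_apply]
    intro t t' h
    refine h1 (hc.1 ?_)
    rw [← SmashHom.of_eval, ← SmashHom.of_eval, h]
  · intro a
    obtain ⟨t, ht⟩ := hc.2 (Smash.of α g a)
    refine ⟨(SmashHom.proj α g).lTensor A t, ?_⟩
    have h : SmashHom.eval α g ∘ₗ (SmashHom.proj α g).lTensor A =
        Smash.coef α g ∘ₗ counitMap k A (envAct (Smash.incl α)) := by
      refine TensorProduct.ext' fun a φ => ?_
      rw [LinearMap.comp_apply, LinearMap.lTensor_tmul, SmashHom.eval_tmul, SmashHom.proj_apply,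
        Smash.coef_of]
      rfl
    refine (LinearMap.congr_fun h t).trans ?_
    rw [LinearMap.comp_apply, ht, Smash.coef_of]

/-! ### The unit of the adjunction for a tensor product of Taylor–Azumaya algebras. -/

section TensorUnit

variable {k A B : Type u} [CommRing k]
  [NonUnitalRing A] [Module k A] [IsScalarTower k A A] [SMulCommClass k A A]
  [NonUnitalRing B] [Module k B] [IsScalarTower k B B] [SMulCommClass k B B]

/-- The map `x ↦ a x a'`. -/
def sandwich (a a' : A) : A →ₗ[k] A := LinearMap.mulLeft k a ∘ₗ LinearMap.mulRight k a'

theorem sandwich_apply (a a' x : A) : sandwich (k := k) a a' x = a * (x * a') := rfl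

theorem sandwich_comp (a a' u w : A) :
    sandwich (k := k) a a' ∘ₗ sandwich u w = sandwich (a * u) (w * a') := by
  ext x
  simp [sandwich_apply, mul_assoc]

/-- A linear map on `A` is `Aᵉ`-linear if it commutes with all `x ↦ a x a'`. -/
theorem mem_moduleHom_tensorAct {N : Type u} [AddCommGroup N] [Module k N] (f : A →ₗ[k] A ⊗[k] N) :
    f ∈ moduleHom (selfAct k A) (tensorAct (selfAct k A) N) ↔
      ∀ a a' x, f (sandwich (k := k) a a' x) = (sandwich a a').rTensor N (f x) := by
  constructor
  · intro h a a' x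
    exact h (a ⊗ₜ MulOpposite.op a') x
  · intro h r x
    induction r with
    | zero => simp
    | add r r' hr hr' => simp only [map_add, LinearMap.add_apply, hr, hr']
    | tmul a a' => exact h a a'.unop x

/-- After reassociation $A$ and $B$ act on separate factors, so that the units for $A$ (at $B\otimes
N$) and for $B$ (at $N$) can be used in turn. -/
theorem assoc_rTensor_sandwich {N : Type u} [AddCommGroup N] [Module k N] (a a' : A) (b b' : B)
    (t : (A ⊗[k] B) ⊗[k] N) :
    TensorProduct.assoc k A B N ((sandwich (a ⊗ₜ[k] b) (a' ⊗ₜ[k] b')).rTensor N t) =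
      TensorProduct.map (sandwich a a') ((sandwich b b').rTensor N)
        (TensorProduct.assoc k A B N t) := by
  suffices h : (TensorProduct.assoc k A B N).toLinearMap ∘ₗ
      (sandwich (a ⊗ₜ[k] b) (a' ⊗ₜ[k] b')).rTensor N =
      TensorProduct.map (sandwich a a') ((sandwich b b').rTensor N) ∘ₗ
        (TensorProduct.assoc k A B N).toLinearMap from LinearMap.congr_fun h t
  refine TensorProduct.ext_threefold fun x y n => ?_
  simp [sandwich_apply, Algebra.TensorProduct.tmul_mul_tmul]

/-- The unit of the adjunction for `A ⊗ B` is an isomorphism. -/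
theorem unitMap_tensor_bijective [IsTaylorAzumaya k A] [IsTaylorAzumaya k B]
    (N : Type u) [AddCommGroup N] [Module k N] :
    Function.Bijective (unitMap k (A ⊗[k] B) N) := by
  have hA := IsTaylorAzumaya.unit_bijective (k := k) (A := A) (B ⊗[k] N)
  have hB := IsTaylorAzumaya.unit_bijective (k := k) (A := B) N
  have injA : ∀ t t' : B ⊗[k] N, (∀ a : A, a ⊗ₜ[k] t = a ⊗ₜ[k] t') → t = t' := fun t t' h =>
    hA.1 (Subtype.ext (LinearMap.ext h))
  have injB : ∀ t t' : N, (∀ b : B, b ⊗ₜ[k] t = b ⊗ₜ[k] t') → t = t' := fun t t' h =>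
    hB.1 (Subtype.ext (LinearMap.ext h))
  constructor
  · intro n n' h
    refine injB n n' fun b => injA _ _ fun a => ?_
    have := LinearMap.congr_fun (congrArg Subtype.val h) (a ⊗ₜ b)
    exact congrArg (TensorProduct.assoc k A B N) this
  · intro f
    let F : A →ₗ[k] B →ₗ[k] A ⊗[k] (B ⊗[k] N) :=
      TensorProduct.curry ((TensorProduct.assoc k A B N).toLinearMap ∘ₗ f.1)
    have hF : ∀ a a' x b b' y, F (sandwich (k := k) a a' x) (sandwich (k := k) b b' y) =
        TensorProduct.map (sandwich a a') ((sandwich b b').rTensor N) (F x y) := by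
      intro a a' x b b' y
      have := (mem_moduleHom_tensorAct f.1).1 f.2 (a ⊗ₜ b) (a' ⊗ₜ b') (x ⊗ₜ y)
      have := congrArg (TensorProduct.assoc k A B N) this
      rw [assoc_rTensor_sandwich] at this
      refine Eq.trans ?_ this
      simp only [F, sandwich_apply, TensorProduct.curry_apply, LinearMap.comp_apply,
        LinearEquiv.coe_coe, Algebra.TensorProduct.tmul_mul_tmul]
    -- Linearity over $A^{\rm e}$ alone does not follow by setting $b=b'=1$. With $x=uvw$ and
    -- $y=pqr$, joint linearity pulls out $u,w,p,r$ both with and without $a,a'$, and the two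
    -- results are compared.
    have hFA : ∀ a a' x y, F (sandwich (k := k) a a' x) y =
        (sandwich a a').rTensor (B ⊗[k] N) (F x y) := by
      intro a a' x y
      suffices h : F ∘ₗ sandwich a a' = F.compr₂ ((sandwich a a').rTensor (B ⊗[k] N)) from
        LinearMap.congr_fun (LinearMap.congr_fun h x) y
      refine ext_on_mul_mul fun u v w => ext_on_mul_mul fun p q r => ?_
      have h1 := hF (a * u) (w * a') v p r q
      have h2 := hF u w v p r q
      simp only [sandwich_apply] at h1 h2
      simp only [LinearMap.comp_apply, LinearMap.compr₂_apply, sandwich_apply]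
      rw [h2]
      have e : a * (u * (v * w) * a') = a * u * (v * (w * a')) := by simp only [mul_assoc]
      rw [e, h1, LinearMap.rTensor_map, sandwich_comp]
    have hFB : ∀ b b' x y, F x (sandwich (k := k) b b' y) =
        ((sandwich b b').rTensor N).lTensor A (F x y) := by
      intro b b' x y
      suffices h : F.flip ∘ₗ sandwich b b' =
          F.flip.compr₂ (((sandwich b b').rTensor N).lTensor A) from
        LinearMap.congr_fun (LinearMap.congr_fun h y) x
      refine ext_on_mul_mul fun u v w => ext_on_mul_mul fun p q r => ?_
      have h1 := hF p r q (b * u) (w * b') v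
      have h2 := hF p r q u w v
      simp only [sandwich_apply] at h1 h2
      simp only [LinearMap.comp_apply, LinearMap.compr₂_apply, sandwich_apply,
        LinearMap.flip_apply]
      rw [h2]
      have e : b * (u * (v * w) * b') = b * u * (v * (w * b')) := by simp only [mul_assoc]
      rw [e, h1, LinearMap.lTensor_map, ← LinearMap.rTensor_comp, sandwich_comp]
    let U := LinearEquiv.ofBijective _ hA
    -- For fixed $y$ the map $F(-,y)$ is $A^{\rm e}$-linear, so the unit for $A$ gives
    -- $F(x,y)=x\otimes T(y)$.
    let T : B →ₗ[k] B ⊗[k] N := U.symm.toLinearMap ∘ₗ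
      LinearMap.codRestrict _ F.flip fun y => (mem_moduleHom_tensorAct _).2 fun a a' x =>
        hFA a a' x y
    have hT : ∀ x y, x ⊗ₜ[k] T y = F x y := by
      intro x y
      have h : U (T y) = ⟨F.flip y, (mem_moduleHom_tensorAct _).2 fun a a' x => hFA a a' x y⟩ :=
        U.apply_symm_apply _
      exact LinearMap.congr_fun (congrArg Subtype.val h) x
    -- By `injA`, $T$ inherits $B^{\rm e}$-linearity from $F$, and the unit for $B$ gives
    -- $T(y)=y\otimes n$.
    obtain ⟨n, hn⟩ := hB.2 ⟨T, (mem_moduleHom_tensorAct _).2 fun b b' y =>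
      injA _ _ fun x => by rw [hT, hFB, ← hT, LinearMap.lTensor_tmul]⟩
    refine ⟨n, Subtype.ext (TensorProduct.ext' fun x y => ?_)⟩
    apply (TensorProduct.assoc k A B N).injective
    change x ⊗ₜ[k] (y ⊗ₜ[k] n) = F x y
    rw [← hT]
    exact congrArg _ (LinearMap.congr_fun (congrArg Subtype.val hn) y)

end TensorUnit

/-! ### Computing ${\rm Hom}_{C^{\rm e}}(C,C\# kG)$ from isomorphisms $C\otimes N_g\cong C\# g$. -/

section TwistedSum

variable {k G C : Type u} [CommRing k] [Group G]
  [NonUnitalRing C] [Module k C] [IsScalarTower k C C] [SMulCommClass k C C]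

theorem exists_tensor_directSum_equiv_smash (γ : AlgAction k G C)
    {N : G → Type u} [∀ g, AddCommGroup (N g)] [∀ g, Module k (N g)]
    (e : ∀ g, C ⊗[k] N g ≃ₗ[k] C) :
    ∃ E : C ⊗[k] (⨁ g, N g) ≃ₗ[k] Smash γ, ∀ c x g,
      Smash.coef γ g (E (c ⊗ₜ x)) = e g (c ⊗ₜ x g) := by
  classical
  let E : C ⊗[k] (⨁ g, N g) ≃ₗ[k] (G →₀ C) := TensorProduct.directSumRight k k C N ≪≫ₗ
    DFinsupp.mapRange.linearEquiv e ≪≫ₗ (finsuppLEquivDirectSum k C G).symm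
  refine ⟨E, fun c x g => ?_⟩
  change E (c ⊗ₜ x) g = _
  rw [LinearEquiv.trans_apply, LinearEquiv.trans_apply, ← finsuppLEquivDirectSum_apply k C G, LinearEquiv.apply_symm_apply]
  refine (DFinsupp.mapRange_apply (fun i => e i) (fun i => map_zero (e i)) _ _).trans ?_
  exact congrArg (e g) (TensorProduct.directSumRight_tmul k k c x g)

/-- If the `A # g` are of the form `A ⊗ N_g`, then `Hom_{Aᵉ}(A, A # kG)` is `⨁ N_g`. -/
theorem exists_directSum_equiv_smashHom (γ : AlgAction k G C)
    (hU : ∀ (N : Type u) [AddCommGroup N] [Module k N], Function.Bijective (unitMap k C N))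
    {N : G → Type u} [∀ g, AddCommGroup (N g)] [∀ g, Module k (N g)]
    (e : ∀ g, C ⊗[k] N g ≃ₗ[k] C)
    (he : ∀ g a c n, e g ((a * c) ⊗ₜ n) = a * e g (c ⊗ₜ n))
    (he' : ∀ g a c n, e g ((c * a) ⊗ₜ n) = e g (c ⊗ₜ n) * γ.rho g a) :
    ∃ Θ : (⨁ g, N g) ≃ₗ[k] SmashHom γ, ∀ c x g,
      Smash.coef γ g ((Θ x).1 c) = e g (c ⊗ₜ x g) := by
  obtain ⟨E, hE⟩ := exists_tensor_directSum_equiv_smash γ e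
  have hEl : ∀ a c x, E ((a * c) ⊗ₜ x) = Smash.incl γ a * E (c ⊗ₜ x) := fun a c x =>
    Smash.ext_coef fun g => by rw [hE, Smash.coef_incl_mul, hE, he]
  have hEr : ∀ a c x, E ((c * a) ⊗ₜ x) = E (c ⊗ₜ x) * Smash.incl γ a := fun a c x =>
    Smash.ext_coef fun g => by rw [hE, Smash.coef_mul_incl, hE, he']
  have hEs : ∀ a a' t, E ((sandwich a a').rTensor _ t) =
      Smash.incl γ a * (E t * Smash.incl γ a') := by
    intro a a' t
    induction t with
    | zero => simp
    | add x y hx hy => simp only [map_add, add_mul, mul_add, hx, hy]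
    | tmul c x => rw [LinearMap.rTensor_tmul, sandwich_apply, hEl, hEr]
  -- The unit of the adjunction followed by composition with `E`.
  let Θ : (⨁ g, N g) →ₗ[k] SmashHom γ := LinearMap.codRestrict _
    ((TensorProduct.mk k C (⨁ g, N g)).compr₂ E.toLinearMap).flip fun x =>
      EnvHom.mem_of_map_mul _ (fun a b => hEl a b x) (fun a b => hEr b a x)
  have hΘ : ∀ x c, (Θ x).1 c = E (c ⊗ₜ x) := fun _ _ => rfl
  have bij : Function.Bijective Θ := by
    constructor
    · intro x y h
      refine (hU _).1 (Subtype.ext (LinearMap.ext fun c => E.injective ?_))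
      exact LinearMap.congr_fun (congrArg Subtype.val h) c
    · intro φ
      -- A homomorphism $C\to C\otimes\bigoplus_g N_g$ is $c\mapsto c\otimes x$ for a single $x$.
      -- The finite support of $x$ bounds the degrees of $\varphi(c)$ uniformly in $c$.
      obtain ⟨x, hx⟩ := (hU (⨁ g, N g)).2 ⟨E.symm.toLinearMap ∘ₗ φ.1,
        (mem_moduleHom_tensorAct _).2 fun a a' c => by
          apply E.injective
          rw [hEs]
          simp only [LinearMap.comp_apply, LinearEquiv.coe_coe, LinearEquiv.apply_symm_apply]
          exact φ.2 (a ⊗ₜ MulOpposite.op a') c⟩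
      refine ⟨x, Subtype.ext (LinearMap.ext fun c => ?_)⟩
      rw [hΘ, ← LinearEquiv.eq_symm_apply]
      exact LinearMap.congr_fun (congrArg Subtype.val hx) c
  exact ⟨LinearEquiv.ofBijective Θ bij, fun c x g => hE c x g⟩

variable [IsUnitalAlgebra k C]

-- With `equiv_lof_of_mem_part`: the coefficient formula forces `Θ` to match the summand $N_g$
-- exactly with the part of degree $g$.
open scoped Classical in
theorem equiv_lof_mem_part {γ : AlgAction k G C}
    {N : G → Type u} [∀ g, AddCommGroup (N g)] [∀ g, Module k (N g)]
    {e : ∀ g, C ⊗[k] N g ≃ₗ[k] C} {Θ : (⨁ g, N g) ≃ₗ[k] SmashHom γ}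
    (hΘ : ∀ c x g, Smash.coef γ g ((Θ x).1 c) = e g (c ⊗ₜ x g)) (g : G) (n : N g) :
    Θ (DirectSum.lof k G N g n) ∈ (smashHomGrading γ).part g := by
  refine mem_smashHomGrading_part.2 fun c => Smash.ext_coef fun h => ?_
  by_cases hgh : g = h
  · subst hgh; rw [Smash.coef_of]
  · rw [Smash.coef_of_ne _ hgh, hΘ, DirectSum.lof_eq_of, DirectSum.of_eq_of_ne _ _ _ (Ne.symm hgh),
      TensorProduct.tmul_zero, map_zero]

open scoped Classical in
theorem equiv_lof_of_mem_part {γ : AlgAction k G C}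
    {N : G → Type u} [∀ g, AddCommGroup (N g)] [∀ g, Module k (N g)]
    {e : ∀ g, C ⊗[k] N g ≃ₗ[k] C} {Θ : (⨁ g, N g) ≃ₗ[k] SmashHom γ}
    (hΘ : ∀ c x g, Smash.coef γ g ((Θ x).1 c) = e g (c ⊗ₜ x g)) (g : G) (x : ⨁ g, N g)
    (hx : Θ x ∈ (smashHomGrading γ).part g) :
    DirectSum.lof k G N g (x g) = x := by
  refine Θ.injective (Subtype.ext (LinearMap.ext fun c => ?_))
  rw [← mem_smashHomGrading_part.1 hx c,
    ← mem_smashHomGrading_part.1 (equiv_lof_mem_part hΘ g (x g)) c, hΘ, hΘ, DirectSum.lof_eq_of,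
    DirectSum.of_eq_same]

/-- Independence of the homogeneous parts is clear from coefficients. The point is that they span:
each $\varphi$ is the image under `Θ` of a finite sum of homogeneous elements. -/
theorem isGraded_of_equiv {γ : AlgAction k G C}
    {N : G → Type u} [∀ g, AddCommGroup (N g)] [∀ g, Module k (N g)]
    {e : ∀ g, C ⊗[k] N g ≃ₗ[k] C} {Θ : (⨁ g, N g) ≃ₗ[k] SmashHom γ}
    (hΘ : ∀ c x g, Smash.coef γ g ((Θ x).1 c) = e g (c ⊗ₜ x g)) :
    (smashHomGrading γ).IsGraded := by
  classical
  have coef : ∀ (y : ⨁ g, (smashHomGrading γ).part g) (g : G) (c : C),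
      Smash.coef γ g ((DirectSum.coeAddMonoidHom (smashHomGrading γ).part y).1 c) =
        Smash.coef γ g ((y g).1.1 c) := by
    intro y g c
    induction y using DirectSum.induction_on with
    | zero => simp
    | add x y hx hy =>
      rw [map_add, DirectSum.add_apply]
      exact (map_add (Smash.coef γ g) _ _).trans
        ((congrArg₂ _ hx hy).trans (map_add (Smash.coef γ g) _ _).symm)
    | of h φ =>
      rw [DirectSum.coeAddMonoidHom_of]
      by_cases hgh : h = g
      · subst hgh; rw [DirectSum.of_eq_same]
      · rw [DirectSum.of_eq_of_ne _ _ _ (Ne.symm hgh), ← mem_smashHomGrading_part.1 φ.2 c,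
          Smash.coef_of_ne _ hgh]
        exact (map_zero (Smash.coef γ g)).symm
  constructor
  · intro y y' h
    refine DFinsupp.ext fun g => Subtype.ext (Subtype.ext (LinearMap.ext fun c => ?_))
    rw [← mem_smashHomGrading_part.1 (y g).2 c, ← mem_smashHomGrading_part.1 (y' g).2 c, ← coef,
      ← coef, h]
  · intro φ
    obtain ⟨x, rfl⟩ := Θ.surjective φ
    induction x using DirectSum.induction_on with
    | zero => exact ⟨0, by simp⟩
    | add x y hx hy =>
      obtain ⟨x', hx⟩ := hx
      obtain ⟨y', hy⟩ := hy
      exact ⟨x' + y', by rw [map_add, map_add, hx, hy]⟩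
    | of g n => exact ⟨DirectSum.of (fun g => (smashHomGrading γ).part g) g
        ⟨_, equiv_lof_mem_part hΘ g n⟩, DirectSum.coeAddMonoidHom_of _ _ _⟩

end TwistedSum

/-! ### The grading and the isomorphism with the cotensor product. -/

section Main

variable {k G A B : Type u} [CommRing k] [Group G]
  [NonUnitalRing A] [Module k A] [IsScalarTower k A A] [SMulCommClass k A A]
  [NonUnitalRing B] [Module k B] [IsScalarTower k B B] [SMulCommClass k B B]

section Eval

variable [IsUnitalAlgebra k A] (α : AlgAction k G A)

theorem SmashHom.eval_mul_left (g : G) (a c : A) (φ : (smashHomGrading α).part g) :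
    SmashHom.eval α g ((a * c) ⊗ₜ φ) = a * SmashHom.eval α g (c ⊗ₜ φ) := by
  rw [SmashHom.eval_tmul, EnvHom.map_mul_left, Smash.coef_incl_mul, SmashHom.eval_tmul]

theorem SmashHom.eval_mul_right (g : G) (a c : A) (φ : (smashHomGrading α).part g) :
    SmashHom.eval α g ((c * a) ⊗ₜ φ) = SmashHom.eval α g (c ⊗ₜ φ) * α.rho g a := by
  rw [SmashHom.eval_tmul, EnvHom.map_mul_right, Smash.coef_mul_incl, SmashHom.eval_tmul]

variable {α}

theorem SmashHom.coef_mul {g h : G} {s s' : SmashHom α} (hs : s ∈ (smashHomGrading α).part g)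
    (hs' : s' ∈ (smashHomGrading α).part h) (a a' : A) :
    Smash.coef α (g * h) ((s * s').1 (a * a')) =
      Smash.coef α g (s.1 a) * α.rho g (Smash.coef α h (s'.1 a')) := by
  rw [EnvHom.mul_apply, ← mem_smashHomGrading_part.1 hs a, ← mem_smashHomGrading_part.1 hs' a',
    Smash.of_mul_of]
  simp only [Smash.coef_of]

end Eval

variable [IsTaylorAzumaya k A] [IsTaylorAzumaya k B]

/-- `A ⊗ Hom_{Aᵉ}(A, A # g) ≅ A # g`. -/
def SmashHom.evalEquiv (α : AlgAction k G A) (g : G) :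
    A ⊗[k] (smashHomGrading α).part g ≃ₗ[k] A :=
  LinearEquiv.ofBijective _ (SmashHom.eval_bijective α g)

/-- The case $C=A$, with $N_g$ the part of degree $g$ itself. -/
theorem smashHomGrading_isGraded (α : AlgAction k G A) : (smashHomGrading α).IsGraded := by
  obtain ⟨Θ, hΘ⟩ := exists_directSum_equiv_smashHom α
    (fun N _ _ => IsTaylorAzumaya.unit_bijective N) (SmashHom.evalEquiv α)
    (SmashHom.eval_mul_left α) (SmashHom.eval_mul_right α)
  exact isGraded_of_equiv hΘ

/-- `(A ⊗ B) ⊗ (Hom_{Aᵉ}(A, A # g) ⊗ Hom_{Bᵉ}(B, B # g)) ≅ (A ⊗ B) # g`. -/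
def SmashHom.evalTensorEquiv (α : AlgAction k G A) (β : AlgAction k G B) (g : G) :
    (A ⊗[k] B) ⊗[k] ((smashHomGrading α).part g ⊗[k] (smashHomGrading β).part g)
      ≃ₗ[k] A ⊗[k] B :=
  TensorProduct.tensorTensorTensorComm k A B _ _ ≪≫ₗ
    TensorProduct.congr (SmashHom.evalEquiv α g) (SmashHom.evalEquiv β g)

theorem SmashHom.evalTensorEquiv_tmul (α : AlgAction k G A) (β : AlgAction k G B) (g : G)
    (a : A) (b : B) (φ : (smashHomGrading α).part g) (ψ : (smashHomGrading β).part g) :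
    SmashHom.evalTensorEquiv α β g ((a ⊗ₜ b) ⊗ₜ (φ ⊗ₜ ψ)) =
      SmashHom.eval α g (a ⊗ₜ φ) ⊗ₜ SmashHom.eval β g (b ⊗ₜ ψ) := rfl

/-- With `SmashHom.evalTensorEquiv_mul_right`: the isomorphism onto $(A\otimes B)\# g$ is one of
bimodules, the right action being twisted by the diagonal action of $g$. -/
theorem SmashHom.evalTensorEquiv_mul_left (α : AlgAction k G A) (β : AlgAction k G B) (g : G)
    (x y : A ⊗[k] B) (n : (smashHomGrading α).part g ⊗[k] (smashHomGrading β).part g) :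
    SmashHom.evalTensorEquiv α β g ((x * y) ⊗ₜ n) =
      x * SmashHom.evalTensorEquiv α β g (y ⊗ₜ n) := by
  induction x with
  | zero => simp
  | add x x' h h' => simp only [add_mul, TensorProduct.add_tmul, map_add, h, h']
  | tmul a b =>
    induction y with
    | zero => simp
    | add x x' h h' => simp only [mul_add, TensorProduct.add_tmul, map_add, h, h']
    | tmul c d =>
      induction n with
      | zero => simp
      | add x x' h h' => simp only [mul_add, TensorProduct.tmul_add, map_add, h, h']
      | tmul φ ψ =>
        rw [Algebra.TensorProduct.tmul_mul_tmul, evalTensorEquiv_tmul, evalTensorEquiv_tmul,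
          eval_mul_left, eval_mul_left, Algebra.TensorProduct.tmul_mul_tmul]

theorem SmashHom.evalTensorEquiv_mul_right (α : AlgAction k G A) (β : AlgAction k G B) (g : G)
    (x y : A ⊗[k] B) (n : (smashHomGrading α).part g ⊗[k] (smashHomGrading β).part g) :
    SmashHom.evalTensorEquiv α β g ((y * x) ⊗ₜ n) =
      SmashHom.evalTensorEquiv α β g (y ⊗ₜ n) * (α.tensor β).rho g x := by
  induction x with
  | zero => simp
  | add x x' h h' => simp only [mul_add, TensorProduct.add_tmul, map_add, h, h']
  | tmul a b =>
    induction y with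
    | zero => simp
    | add x x' h h' => simp only [add_mul, TensorProduct.add_tmul, map_add, h, h']
    | tmul c d =>
      induction n with
      | zero => simp
      | add x x' h h' => simp only [add_mul, TensorProduct.tmul_add, map_add, h, h']
      | tmul φ ψ =>
        rw [Algebra.TensorProduct.tmul_mul_tmul, evalTensorEquiv_tmul, evalTensorEquiv_tmul,
          eval_mul_right, eval_mul_right]
        exact (Algebra.TensorProduct.tmul_mul_tmul _ _ _ _).symm

/-- The case $C=A\otimes B$, $N_g=S_g\otimes T_g$; it remains to see that the linear bijection
respects unit, product and degrees. -/
theorem smashHomGrading_tensor (α : AlgAction k G A) (β : AlgAction k G B) :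
    (smashHomGrading (α.tensor β)).IsGraded ∧
    Nonempty (GradedAlgEquiv (Cotensor.grading (smashHomGrading α) (smashHomGrading β))
      (smashHomGrading (α.tensor β))) := by
  classical
  obtain ⟨Θ, hΘ⟩ := exists_directSum_equiv_smashHom (α.tensor β)
    (fun N _ _ => unitMap_tensor_bijective N) (SmashHom.evalTensorEquiv α β)
    (SmashHom.evalTensorEquiv_mul_left α β) (SmashHom.evalTensorEquiv_mul_right α β)
  refine ⟨isGraded_of_equiv hΘ, ?_⟩
  let 𝒮 := smashHomGrading α
  let 𝒯 := smashHomGrading β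
  let Θ' : Cotensor 𝒮 𝒯 ≃ₗ[k] SmashHom (α.tensor β) := Θ
  have hof : ∀ g n, Θ' (Cotensor.of 𝒮 𝒯 g n) ∈ (smashHomGrading (α.tensor β)).part g :=
    equiv_lof_mem_part hΘ
  -- This explicit value on pure tensors determines the map; unit and product are both checked from
  -- it.
  have htmul : ∀ g s hs t ht a b, (Θ' (Cotensor.tmul 𝒮 𝒯 g s hs t ht)).1 (a ⊗ₜ b) =
      Smash.of (α.tensor β) g (Smash.coef α g (s.1 a) ⊗ₜ Smash.coef β g (t.1 b)) := by
    intro g s hs t ht a b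
    refine (mem_smashHomGrading_part.1 (hof g (⟨s, hs⟩ ⊗ₜ ⟨t, ht⟩)) (a ⊗ₜ b)).symm.trans
      (congrArg _ ?_)
    refine (hΘ (a ⊗ₜ b) (DirectSum.lof k G (fun g => 𝒮.part g ⊗[k] 𝒯.part g) g
      (⟨s, hs⟩ ⊗ₜ ⟨t, ht⟩)) g).trans ?_
    rw [DirectSum.lof_eq_of, DirectSum.of_eq_same]
    rfl
  have hone : Θ' 1 = 1 := by
    refine Subtype.ext (TensorProduct.ext' fun a b => ?_)
    rw [Cotensor.one_def, htmul, EnvHom.one_apply, EnvHom.one_apply, EnvHom.one_apply,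
      Smash.incl_apply, Smash.incl_apply, Smash.incl_apply, Smash.coef_of, Smash.coef_of]
  have happly : ∀ x y u v, (Θ' (x * y)).1 (u * v) = (Θ' x).1 u * (Θ' y).1 v := by
    intro x y u v
    induction x using Cotensor.induction with
    | zero => simp only [zero_mul, map_zero, Submodule.coe_zero, LinearMap.zero_apply]
    | add x x' h h' =>
      simp only [add_mul, map_add, Submodule.coe_add, LinearMap.add_apply, h, h']
    | tmul g s hs t ht =>
      induction y using Cotensor.induction with
      | zero => simp only [mul_zero, map_zero, Submodule.coe_zero, LinearMap.zero_apply]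
      | add x x' h h' =>
        simp only [mul_add, map_add, Submodule.coe_add, LinearMap.add_apply, h, h']
      | tmul h s' hs' t' ht' =>
        induction u with
        | zero => simp only [zero_mul, map_zero]
        | add x x' h h' => simp only [add_mul, map_add, h, h']
        | tmul a b =>
          induction v with
          | zero => simp only [mul_zero, map_zero]
          | add x x' h h' => simp only [mul_add, map_add, h, h']
          | tmul a' b' =>
            -- Here the diagonal action enters: $(a\otimes b)\,g(a'\otimes b')=a(ga')\otimes
            -- b(gb')$, so the smash product on $A\otimes B$ multiplies the two coefficients
            -- separately.
            rw [Cotensor.tmul_mul_tmul, Algebra.TensorProduct.tmul_mul_tmul,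
              htmul, htmul, htmul, Smash.of_mul_of, SmashHom.coef_mul hs hs',
              SmashHom.coef_mul ht ht']
            exact congrArg _ (Algebra.TensorProduct.tmul_mul_tmul _ _ _ _).symm
  have hmul : ∀ x y, Θ' (x * y) = Θ' x * Θ' y := fun x y =>
    EnvHom.ext_mul fun u v => by rw [EnvHom.mul_apply, happly]
  refine ⟨{ AlgEquiv.ofLinearEquiv Θ' hone hmul with map_part := fun g x => ⟨?_, fun hx => ?_⟩ }⟩
  · rintro ⟨n, rfl⟩
    exact hof g n
  · exact ⟨_, equiv_lof_of_mem_part hΘ g x hx⟩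

end Main

end TaylorAzumaya

end

theorem lemma3p7 {k G A B : Type u} [CommRing k] [Group G]
    [NonUnitalRing A] [Module k A] [IsScalarTower k A A] [SMulCommClass k A A]
    [NonUnitalRing B] [Module k B] [IsScalarTower k B B] [SMulCommClass k B B]
    [TaylorAzumaya.IsTaylorAzumaya k A] [TaylorAzumaya.IsTaylorAzumaya k B]
    (α : TaylorAzumaya.AlgAction k G A) (β : TaylorAzumaya.AlgAction k G B) :
    (TaylorAzumaya.smashHomGrading α).IsGraded ∧
    (TaylorAzumaya.smashHomGrading β).IsGraded ∧
    (TaylorAzumaya.smashHomGrading (α.tensor β)).IsGraded ∧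
    Nonempty (TaylorAzumaya.GradedAlgEquiv
      (TaylorAzumaya.Cotensor.grading
        (TaylorAzumaya.smashHomGrading α) (TaylorAzumaya.smashHomGrading β))
      (TaylorAzumaya.smashHomGrading (α.tensor β))) := by
  exact ⟨TaylorAzumaya.smashHomGrading_isGraded α, TaylorAzumaya.smashHomGrading_isGraded β,
    TaylorAzumaya.smashHomGrading_tensor α β⟩
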